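/- Let $\mathfrak h$ be a complex Hilbert space, $n\ge 0$ an integer, $L_1,\dots,L_n$ and $H$ bounded operators on $\mathfrak h$ with $H=H^\ast$, and let $\mathfrak F$ be the Bose Fock space over $L^2([0,\infty);\mathbb C^n)$, with exponential vectors $e(f)$, $\langle e(f),e(g)\rangle=\exp\langle f,g\rangle$, and creation and annihilation operators $a^\ast(f)$, $a(f)$. For $k=1,\dots,n$ and $t\ge 0$ let $$Z_k(t)=\int_0^t\{b_{\mathrm{in},k}(s)+b_{\mathrm{in},k}(s)^\ast\}\,ds$$ be the input quadrature, that is, the closure of $a(1_{[0,t]}\epsilon_k)+a^\ast(1_{[0,t]}\epsilon_k)$, where $\epsilon_k$ is the $k$-th standard basis vector of $\mathbb C^n$. Let $U(t,s)$, $0\le s\le t$, be unitary operators on $\mathfrak h\otimes\mathfrak F$ which form the time-ordered exponential $$U(t,s)=\vec T\exp\int_s^t\Big\{\sum_k\big(L_k\otimes b_{\mathrm{in},k}(r)^\ast-L_k^\ast\otimes b_{\mathrm{in},k}(r)\big)-iH\Big\}dr ,$$ that is, for every $s\ge 0$ the map $t\mapsto U(t,s)$ is strongly continuous on $[s,\infty)$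 and solves the quantum stochastic differential equation $dU(t,s)=\{\sum_k(L_k\,dB_k(t)^\ast-L_k^\ast\,dB_k(t))+K\,dt\}U(t,s)$, $U(s,s)=I$, with $K=-\tfrac12\sum_kL_k^\ast L_k-iH$: for all $t\ge s$, $u,v\in\mathfrak h$ and $f,g\in L^2([0,\infty);\mathbb C^n)$, $$\langle u\otimes e(f),U(t,s)\,v\otimes e(g)\rangle=\langle u\otimes e(f),v\otimes e(g)\rangle+\int_s^t\Big\langle u\otimes e(f),\Big(\Big[\sum_k\big(\overline{f_k(r)}L_k-g_k(r)L_k^\ast\big)+K\Big]\otimes I\Big)U(r,s)\,v\otimes e(g)\Big\rangle dr .$$ Let $Y_k(t)=U(t,0)^\ast\{I\otimes Z_k(t)\}U(t,0)$ be the output quadratures. Then for every $T$ the family $\{Y_k(t):k=1,\dots,n,\ 0\le t\le T\}$ is a commutative family of self-adjoint operators: any two members $Y_j(t)$, $Y_k(s)$ are self-adjoint and commute strongly (their resolvents $(Y_j(t)-z)^{-1}$ and $(Y_k(s)-w)^{-1}$ commute for all non-real $z,w$), and $[Y_j(t),Y_k(s)]x=0$ for every vector $x$ in the domains of both products $Y_j(t)Y_k(s)$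 and $Y_k(s)Y_j(t)$. -/

import Mathlib

open MeasureTheory
open scoped InnerProductSpace TensorProduct ComplexConjugate ComplexOrder

noncomputable section

/-! ### The Bose Fock space -/

/-- The exponential kernel `(f, g) ↦ exp ⟪f, g⟫` on a complex Hilbert space, with values in
the operators on `ℂ`. -/
def expKernel (E : Type*) [NormedAddCommGroup E] [InnerProductSpace ℂ E] :
    Matrix E E (ℂ →L[ℂ] ℂ) :=
  Matrix.of fun f g => Complex.exp ⟪f, g⟫_ℂ • ContinuousLinearMap.id ℂ ℂ

theorem posSemidef_inner {E F : Type*} [NormedAddCommGroup F] [InnerProductSpace ℂ F]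
    (v : E → F) : (Matrix.of fun f g : E => ⟪v f, v g⟫_ℂ).PosSemidef := by
  refine ⟨?_, fun x => ?_⟩
  · ext f g
    simp [Matrix.conjTranspose_apply]
  · have h : (x.sum fun i xi => x.sum fun j xj =>
        star xi * (Matrix.of fun f g : E => ⟪v f, v g⟫_ℂ) i j * xj) =
        ⟪x.sum fun i xi => xi • v i, x.sum fun i xi => xi • v i⟫_ℂ := by
      simp only [Finsupp.sum, sum_inner]
      refine Finset.sum_congr rfl fun i _ => ?_
      rw [inner_sum]
      refine Finset.sum_congr rfl fun j _ => ?_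
      simp only [Matrix.of_apply, inner_smul_left, inner_smul_right, RCLike.star_def]
      ring
    rw [h, inner_self_eq_norm_sq_to_K]
    positivity

theorem posSemidef_inner_pow (E : Type*) [NormedAddCommGroup E] [InnerProductSpace ℂ E] (m : ℕ) :
    (Matrix.of fun f g : E => ⟪f, g⟫_ℂ ^ m).PosSemidef := by
  induction m with
  | zero =>
    have h := posSemidef_inner (fun _ : E => (1 : ℂ))
    simpa using h
  | succ m ih => exact ih.hadamard (posSemidef_inner (fun f : E => f))

theorem posSemidef_expKernel (E : Type*) [NormedAddCommGroup E] [InnerProductSpace ℂ E] :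
    (expKernel E).PosSemidef := by
  have h0 := (RKHS.posSemidef_tfae (K := expKernel E)).out 0 2
  rw [h0]
  refine ⟨?_, fun vv => ?_⟩
  · ext f g
    have h1 : star (ContinuousLinearMap.id ℂ ℂ) = ContinuousLinearMap.id ℂ ℂ :=
      star_one (ℂ →L[ℂ] ℂ)
    simp [expKernel, Matrix.conjTranspose_apply, ← Complex.exp_conj, h1]
  · have key : 0 ≤ vv.sum fun x w => vv.sum fun x' w' =>
        star w * Complex.exp ⟪x, x'⟫_ℂ * w' := by
      have hs : HasSum (fun m : ℕ => vv.sum fun x w => vv.sum fun x' w' =>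
          ((m.factorial : ℂ)⁻¹) * (star w * ⟪x, x'⟫_ℂ ^ m * w'))
          (vv.sum fun x w => vv.sum fun x' w' => star w * Complex.exp ⟪x, x'⟫_ℂ * w') := by
        refine hasSum_sum fun x _ => hasSum_sum fun x' _ => ?_
        have h := NormedSpace.expSeries_div_hasSum_exp (𝔸 := ℂ) ⟪x, x'⟫_ℂ
        rw [← Complex.exp_eq_exp_ℂ] at h
        refine ((h.mul_left (star (vv x))).mul_right (vv x')).congr_fun fun m => ?_
        ring
      refine hs.nonneg fun m => ?_
      have h := (posSemidef_inner_pow E m).2 vv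
      have h2 : (vv.sum fun x w => vv.sum fun x' w' =>
          ((m.factorial : ℂ)⁻¹) * (star w * ⟪x, x'⟫_ℂ ^ m * w')) =
          ((m.factorial : ℂ)⁻¹) * vv.sum fun x w => vv.sum fun x' w' =>
            star w * ⟪x, x'⟫_ℂ ^ m * w' := by
        simp only [Finsupp.mul_sum]
      rw [h2]
      exact mul_nonneg (by positivity) h
    have h3 : (vv.sum fun x w => vv.sum fun x' w' => ⟪(expKernel E x' x) w, w'⟫_ℂ) =
        vv.sum fun x w => vv.sum fun x' w' => star w * Complex.exp ⟪x, x'⟫_ℂ * w' := by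
      refine Finsupp.sum_congr fun x _ => Finsupp.sum_congr fun x' _ => ?_
      simp [expKernel, ← Complex.exp_conj]
      ring
    rw [h3]
    exact (Complex.le_def.mp key).1

instance instFactPosSemidefExpKernel (E : Type*) [NormedAddCommGroup E]
    [InnerProductSpace ℂ E] : Fact (expKernel E).PosSemidef :=
  ⟨posSemidef_expKernel E⟩

/-- The Bose (symmetric) Fock space over the one-particle space `E`: the Hilbert space generated
by total vectors `e(f)`, `f ∈ E`, with `⟪e(f), e(g)⟫ = exp ⟪f, g⟫`. It is the symmetric Fock space
`⨁ₘ E^{⊗ₛ m}`, in which `e(f) = ⨁ₘ f^{⊗ m} / √(m!)`, in its reproducing kernel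
(Segal--Bargmann) form. -/
abbrev Fock (E : Type*) [NormedAddCommGroup E] [InnerProductSpace ℂ E] : Type _ :=
  RKHS.OfKernel (expKernel E)

/-- The exponential (unnormalised coherent) vector `e(f)`; `e(0)` is the vacuum. -/
def expVec {E : Type*} [NormedAddCommGroup E] [InnerProductSpace ℂ E] (f : E) : Fock E :=
  RKHS.kerFun (Fock E) f 1

theorem inner_expVec {E : Type*} [NormedAddCommGroup E] [InnerProductSpace ℂ E] (f g : E) :
    ⟪expVec f, expVec g⟫_ℂ = Complex.exp ⟪f, g⟫_ℂ := by
  rw [expVec, expVec, RKHS.kerFun_inner, RKHS.kerFun_apply, RKHS.OfKernel.kernel_ofKernel]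
  simp [expKernel]

theorem span_expVec_dense (E : Type*) [NormedAddCommGroup E] [InnerProductSpace ℂ E] :
    (Submodule.span ℂ (Set.range (expVec (E := E)))).topologicalClosure = ⊤ := by
  rw [eq_top_iff, ← RKHS.kerFun_dense (Fock E)]
  refine Submodule.topologicalClosure_mono (Submodule.span_le.mpr ?_)
  rintro _ ⟨f, v, rfl⟩
  have h : RKHS.kerFun (Fock E) f v = v • expVec f := by
    rw [expVec, ← map_smul, smul_eq_mul, mul_one]
  rw [h]
  exact Submodule.smul_mem _ _ (Submodule.subset_span ⟨f, rfl⟩)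

/-- The creation operator `a†(f)`, on its maximal domain: `a†(f) ψ = φ` if and only if
`⟪e(g), φ⟫ = ⟪g, f⟫ ⟪e(g), ψ⟫` for all `g`. -/
def creation {E : Type*} [NormedAddCommGroup E] [InnerProductSpace ℂ E] (f : E) :
    Fock E →ₗ.[ℂ] Fock E :=
  Submodule.toLinearPMap
    { carrier := {p | ∀ g : E, ⟪expVec g, p.2⟫_ℂ = ⟪g, f⟫_ℂ * ⟪expVec g, p.1⟫_ℂ}
      add_mem' := fun {p q} hp hq g => by
        simp only [Set.mem_ofPred_eq] at hp hq
        rw [Prod.snd_add, Prod.fst_add, inner_add_right, inner_add_right, hp g, hq g, mul_add]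
      zero_mem' := fun g => by simp
      smul_mem' := fun c p hp g => by
        simp only [Set.mem_ofPred_eq] at hp
        rw [Prod.smul_snd, Prod.smul_fst, inner_smul_right, inner_smul_right, hp g]
        ring }

/-- The annihilation operator `a(f)`, the Hilbert space adjoint of `a†(f)`. -/
def annihilation {E : Type*} [NormedAddCommGroup E] [InnerProductSpace ℂ E] (f : E) :
    Fock E →ₗ.[ℂ] Fock E :=
  (creation f).adjoint

/-! ### Hilbert space tensor products -/

/-- The Hilbert space tensor product. -/
abbrev HTensor (E F : Type*) [NormedAddCommGroup E] [InnerProductSpace ℂ E]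
    [NormedAddCommGroup F] [InnerProductSpace ℂ F] : Type _ :=
  UniformSpace.Completion (E ⊗[ℂ] F)

/-- The elementary tensor `u ⊗ ψ` in the Hilbert space tensor product. -/
def htmul {E F : Type*} [NormedAddCommGroup E] [InnerProductSpace ℂ E]
    [NormedAddCommGroup F] [InnerProductSpace ℂ F] (u : E) (ψ : F) : HTensor E F :=
  ((u ⊗ₜ[ℂ] ψ : E ⊗[ℂ] F) : UniformSpace.Completion (E ⊗[ℂ] F))

/-- The bounded operator `X ⊗ I`. -/
def tensorId {E : Type*} (F : Type*) [NormedAddCommGroup E] [InnerProductSpace ℂ E]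
    [NormedAddCommGroup F] [InnerProductSpace ℂ F] (X : E →L[ℂ] E) :
    HTensor E F →L[ℂ] HTensor E F :=
  (X.rTensor F).completion

/-- The operator `I ⊗ A` for a possibly unbounded `A`: the closure of the operator
`u ⊗ ψ ↦ u ⊗ A ψ` on the algebraic tensor product of `E` with the domain of `A`. -/
def idTensor (E : Type*) {F : Type*} [NormedAddCommGroup E] [InnerProductSpace ℂ E]
    [NormedAddCommGroup F] [InnerProductSpace ℂ F] (A : F →ₗ.[ℂ] F) :
    HTensor E F →ₗ.[ℂ] HTensor E F :=
  (Submodule.toLinearPMap (Submodule.span ℂ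
    {p : HTensor E F × HTensor E F |
      ∃ (u : E) (ψ : A.domain), p = (htmul u (ψ : F), htmul u (A ψ))})).closure

/-! ### Unbounded operators -/

/-- The operator `V* A V`, for a unitary `V` and a possibly unbounded operator `A`. -/
def unitaryConj {K : Type*} [NormedAddCommGroup K] [InnerProductSpace ℂ K] [CompleteSpace K]
    (V : unitary (K →L[ℂ] K)) (A : K →ₗ.[ℂ] K) : K →ₗ.[ℂ] K where
  domain := A.domain.comap (V : K →L[ℂ] K).toLinearMap
  toFun := (star (V : K →L[ℂ] K)).toLinearMap ∘ₗ A.toFun ∘ₗ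
    (V : K →L[ℂ] K).toLinearMap.restrict (fun _ hx => hx)

/-- `R` is the bounded inverse of `A - z`. -/
def IsResolvent {K : Type*} [NormedAddCommGroup K] [InnerProductSpace ℂ K]
    (A : K →ₗ.[ℂ] K) (z : ℂ) (R : K →L[ℂ] K) : Prop :=
  (∀ x : K, ∃ hx : R x ∈ A.domain, A ⟨R x, hx⟩ - z • R x = x) ∧
    ∀ x : A.domain, R (A x - z • (x : K)) = x

/-- Strong commutativity of possibly unbounded self-adjoint operators: both are self-adjoint, and
all their resolvents at non-real points exist and commute (equivalently, their spectral
projections commute). -/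
def StronglyCommute {K : Type*} [NormedAddCommGroup K] [InnerProductSpace ℂ K] [CompleteSpace K]
    (A B : K →ₗ.[ℂ] K) : Prop :=
  IsSelfAdjoint A ∧ IsSelfAdjoint B ∧
    ∀ z w : ℂ, z.im ≠ 0 → w.im ≠ 0 →
      ∃ R S : K →L[ℂ] K, IsResolvent A z R ∧ IsResolvent B w S ∧ Commute R S

/-- The commutator of `A` and `B` vanishes wherever it is defined: `A B x = B A x` for all `x` in
the domains of both products. -/
def CommutatorVanishes {K : Type*} [NormedAddCommGroup K] [InnerProductSpace ℂ K]
    (A B : K →ₗ.[ℂ] K) : Prop :=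
  ∀ (x : K) (hA : x ∈ A.domain) (hB : x ∈ B.domain)
    (hBA : A ⟨x, hA⟩ ∈ B.domain) (hAB : B ⟨x, hB⟩ ∈ A.domain),
    A ⟨B ⟨x, hB⟩, hAB⟩ = B ⟨A ⟨x, hA⟩, hBA⟩

/-! ### The system coupled to the input fields -/

/-- The one-particle space `L²([0, ∞); ℂⁿ)` of `n` input fields. -/
abbrev OneParticle (n : ℕ) : Type :=
  Lp (EuclideanSpace ℂ (Fin n)) 2 (volume.restrict (Set.Ici (0 : ℝ)))

/-- The bath: the Fock space over `L²([0, ∞); ℂⁿ)`. -/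
abbrev Bath (n : ℕ) : Type := Fock (OneParticle n)

/-- The function `1_{[0, t]}` in the `k`-th channel. -/
def channelIndicator {n : ℕ} (k : Fin n) (t : ℝ) : OneParticle n :=
  indicatorConstLp 2 (s := Set.Icc 0 t) measurableSet_Icc
    ((Measure.restrict_apply_le _ _).trans_lt measure_Icc_lt_top).ne
    (EuclideanSpace.single k (1 : ℂ))

/-- The input quadrature `Z_k(t) = ∫₀ᵗ (b_k(s) + b_k(s)*) ds`: the closure of
`a(1_{[0, t]} ⊗ e_k) + a†(1_{[0, t]} ⊗ e_k)`. -/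
def inputQuadrature {n : ℕ} (k : Fin n) (t : ℝ) : Bath n →ₗ.[ℂ] Bath n :=
  (annihilation (channelIndicator k t) + creation (channelIndicator k t)).closure

/-- The Itô drift coefficient `K = - ½ ∑ₖ Lₖ* Lₖ - i H`. -/
def driftCoeff {n : ℕ} {𝔥 : Type*} [NormedAddCommGroup 𝔥] [InnerProductSpace ℂ 𝔥]
    [CompleteSpace 𝔥] (L : Fin n → 𝔥 →L[ℂ] 𝔥) (H : 𝔥 →L[ℂ] 𝔥) : 𝔥 →L[ℂ] 𝔥 :=
  -((1 / 2 : ℂ) • ∑ k, star (L k) * L k) - Complex.I • H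

/-- The unitary family `U(t, s)`, `0 ≤ s ≤ t`, is the time-ordered exponential of
`∑ₖ (Lₖ ⊗ b_k* - Lₖ* ⊗ b_k) - i H` over `[s, t]`: for each `s` it is the strongly continuous
solution of the quantum stochastic differential equation
`dU(t, s) = (∑ₖ (Lₖ dB_k(t)* - Lₖ* dB_k(t)) + K dt) U(t, s)`, `U(s, s) = I`, expressed by its
matrix elements between the vectors `u ⊗ e(f)` and `v ⊗ e(g)`, on which the increments
`dB_k(r)*` and `dB_k(r)` contribute `conj (f_k(r)) dr` and `g_k(r) dr`. -/
structure IsTimeOrderedExponential {n : ℕ} {𝔥 : Type*} [NormedAddCommGroup 𝔥]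
    [InnerProductSpace ℂ 𝔥] [CompleteSpace 𝔥] (L : Fin n → 𝔥 →L[ℂ] 𝔥) (H : 𝔥 →L[ℂ] 𝔥)
    (U : ℝ → ℝ → unitary (HTensor 𝔥 (Bath n) →L[ℂ] HTensor 𝔥 (Bath n))) : Prop where
  continuousOn : ∀ s : ℝ, 0 ≤ s → ∀ x : HTensor 𝔥 (Bath n),
    ContinuousOn (fun t => (U t s : HTensor 𝔥 (Bath n) →L[ℂ] HTensor 𝔥 (Bath n)) x) (Set.Ici s)
  integral_eq : ∀ s t : ℝ, 0 ≤ s → s ≤ t → ∀ (u v : 𝔥) (f g : OneParticle n),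
    ⟪htmul u (expVec f), (U t s : HTensor 𝔥 (Bath n) →L[ℂ] HTensor 𝔥 (Bath n))
        (htmul v (expVec g))⟫_ℂ =
      ⟪htmul u (expVec f), htmul v (expVec g)⟫_ℂ +
      ∫ r in s..t, ⟪htmul u (expVec f),
        (∑ k, (conj (f r k) • tensorId (Bath n) (L k) - g r k • tensorId (Bath n) (star (L k))) +
          tensorId (Bath n) (driftCoeff L H))
          ((U r s : HTensor 𝔥 (Bath n) →L[ℂ] HTensor 𝔥 (Bath n)) (htmul v (expVec g)))⟫_ℂ

/-- The output quadrature `Y_k(t) = U(t, 0)* (I ⊗ Z_k(t)) U(t, 0)`. -/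
def outputQuadrature {n : ℕ} {𝔥 : Type*} [NormedAddCommGroup 𝔥] [InnerProductSpace ℂ 𝔥]
    (U : ℝ → ℝ → unitary (HTensor 𝔥 (Bath n) →L[ℂ] HTensor 𝔥 (Bath n)))
    (k : Fin n) (t : ℝ) : HTensor 𝔥 (Bath n) →ₗ.[ℂ] HTensor 𝔥 (Bath n) :=
  unitaryConj (U t 0) (idTensor 𝔥 (inputQuadrature k t))

end

/-! For `s ≤ t` the flow property gives `U(t,0) = U(t,s) U(s,0)`, and `U(t,s)` involves only the
field after time `s`, so it commutes with `Z_k(s)`. Hence `Y_k(s) = U(s,0)* Z_k(s) U(s,0) = U(t,0)*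
Z_k(s) U(t,0)`: both outputs are conjugates, by the same unitary, of input quadratures. These
commute because the inner product of two channel indicators is real. The two halves meet in
`IsResolvent.exists_commute_unitaryConj`.

Unbounded operators enter only through resolvents and a core (`HasSelfAdjointCore`), here the
vectors `u ⊗ e(g)`. Trivial deficiency on the core produces resolvents, and turns commutation tested
weakly on the core into commutation with the resolvent
(`HasSelfAdjointCore.commute_of_isResolvent`). For the field operators the deficiency condition
follows from the boundedness of the Weyl orbits (`eq_zero_of_inner_fieldVec`), and their mutual
commutation from the Weyl operators (`commute_isResolvent_fieldOp`).

The dynamics reduces to ordinary differential equations: pairing `U(r,s) (v ⊗ e(g))` with `e(f)`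
gives a curve in `𝔥` solving a linear equation with integrable coefficients read off from `f(r)` and
`g(r)`. Uniqueness (`IsWeakSolution.unique`) shows that the matrix elements factorise, which is the
commutation with the past (`IsTimeOrderedExponential.inner_eq_exp_mul`). It also gives the flow
property, once the equation for `U(r,s)` is known on the vector `U(s,0) (v ⊗ e(g))`. That vector is
not a combination of exponential vectors, but it lies in the closed span of those `w ⊗ e(g')` with
`g' = g` after `s` (`mem_futureSubspace`), and all of these share one equation. -/

noncomputable section

/-! ### Symmetric unbounded operators determined by a core -/

section UnboundedOperators

variable {K : Type*} [NormedAddCommGroup K] [InnerProductSpace ℂ K]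

/-- A linear relation is symmetric if `⟪A x, y⟫ = ⟪x, A y⟫` along its graph. -/
def IsSymmetricGraph (G : Submodule ℂ (K × K)) : Prop :=
  ∀ x ∈ G, ∀ y ∈ G, ⟪x.2, y.1⟫_ℂ = ⟪x.1, y.2⟫_ℂ

theorem IsSymmetricGraph.topologicalClosure {G : Submodule ℂ (K × K)} (hG : IsSymmetricGraph G) :
    IsSymmetricGraph G.topologicalClosure := by
  have h1 : ∀ x ∈ G, ∀ y ∈ closure (G : Set (K × K)), ⟪x.2, y.1⟫_ℂ = ⟪x.1, y.2⟫_ℂ := by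
    intro x hx y hy
    exact closure_minimal (t := {y : K × K | ⟪x.2, y.1⟫_ℂ = ⟪x.1, y.2⟫_ℂ}) (fun y hy => hG x hx y hy)
      (isClosed_eq (by fun_prop) (by fun_prop)) hy
  intro x hx y hy
  exact closure_minimal (t := {x : K × K | ⟪x.2, y.1⟫_ℂ = ⟪x.1, y.2⟫_ℂ}) (fun x hx => h1 x hx y hy)
    (isClosed_eq (by fun_prop) (by fun_prop)) hx

/-- By symmetry `x.2` is orthogonal to all first components, which are total. This is what makes
symmetric relations single-valued, hence closable. -/
theorem IsSymmetricGraph.snd_eq_zero {G : Submodule ℂ (K × K)} (hG : IsSymmetricGraph G)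
    (htot : ∀ ψ : K, (∀ x ∈ G, ⟪x.1, ψ⟫_ℂ = 0) → ψ = 0) (x : K × K) (hx : x ∈ G)
    (h0 : x.1 = 0) : x.2 = 0 := by
  refine htot _ fun y hy => ?_
  rw [← hG y hy x hx, h0, inner_zero_right]

theorem IsSymmetricGraph.graph_toLinearPMap {G : Submodule ℂ (K × K)} (hG : IsSymmetricGraph G)
    (htot : ∀ ψ : K, (∀ x ∈ G, ⟪x.1, ψ⟫_ℂ = 0) → ψ = 0) : G.toLinearPMap.graph = G :=
  G.toLinearPMap_graph_eq fun x hx h0 => hG.snd_eq_zero htot x hx h0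

theorem IsSymmetricGraph.graph_closure {A : K →ₗ.[ℂ] K} (hA : IsSymmetricGraph A.graph)
    (htot : ∀ ψ : K, (∀ x ∈ A.graph, ⟪x.1, ψ⟫_ℂ = 0) → ψ = 0) :
    A.closure.graph = A.graph.topologicalClosure := by
  have hcl : A.IsClosable := by
    refine ⟨A.graph.topologicalClosure.toLinearPMap, ?_⟩
    refine (hA.topologicalClosure.graph_toLinearPMap fun ψ h => htot ψ fun x hx => ?_).symm
    exact h x (A.graph.le_topologicalClosure hx)
  exact hcl.graph_closure_eq_closure_graph.symm

theorem LinearPMap.apply_eq_of_mem_graph {A : K →ₗ.[ℂ] K} {x y : K} (h : (x, y) ∈ A.graph) :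
    ∃ hx : x ∈ A.domain, A ⟨x, hx⟩ = y := by
  obtain ⟨w, h1, h2⟩ := A.mem_graph_iff.mp h
  simp only at h1 h2
  subst h1
  exact ⟨w.2, h2⟩

/-- Since `⟪x, y⟫` is real, the imaginary part of `⟪x, y - z x⟫` is `-Im z ‖x‖²`; Cauchy–Schwarz
does the rest. -/
theorem im_mul_norm_le_norm_sub_smul {x y : K} (z : ℂ) (h : ⟪y, x⟫_ℂ = ⟪x, y⟫_ℂ) :
    |z.im| * ‖x‖ ≤ ‖y - z • x‖ := by
  rcases eq_or_ne x 0 with rfl | hx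
  · simp
  have hx' : 0 < ‖x‖ := norm_pos_iff.mpr hx
  have him : (⟪x, y⟫_ℂ).im = 0 := by
    rw [← inner_conj_symm] at h
    have := congrArg Complex.im h
    simp only [Complex.conj_im] at this
    linarith
  have h1 : (⟪x, y - z • x⟫_ℂ).im = -(z.im * ‖x‖ ^ 2) := by
    rw [inner_sub_right, inner_smul_right, inner_self_eq_norm_sq_to_K, Complex.sub_im, him]
    have h3 : (((‖x‖ : ℝ) : ℂ) ^ 2) = ((‖x‖ ^ 2 : ℝ) : ℂ) := by push_cast; rfl
    simp only [RCLike.ofReal_eq_complex_ofReal, h3, Complex.im_mul_ofReal]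
    ring
  have h2 := (Complex.abs_im_le_norm _).trans (norm_inner_le_norm (𝕜 := ℂ) x (y - z • x))
  rw [h1, abs_neg, abs_mul, abs_of_nonneg (sq_nonneg ‖x‖)] at h2
  have h4 : ‖x‖ * (|z.im| * ‖x‖) ≤ ‖x‖ * ‖y - z • x‖ := by nlinarith
  exact le_of_mul_le_mul_left h4 hx'

/-- `A` is a closed symmetric operator with `A (e i) = q i`, whose deficiency spaces are already
trivial for the restriction of `A` to the span of the `e i`. -/
structure HasSelfAdjointCore {ι : Type*} (A : K →ₗ.[ℂ] K) (e q : ι → K) : Prop where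
  mem_graph : ∀ i, (e i, q i) ∈ A.graph
  symm : IsSymmetricGraph A.graph
  isClosed : IsClosed (A.graph : Set (K × K))
  total : ∀ ψ : K, (∀ i, ⟪e i, ψ⟫_ℂ = 0) → ψ = 0
  deficiency : ∀ (z : ℂ) (ψ : K), z.im ≠ 0 → (∀ i, ⟪q i, ψ⟫_ℂ = z * ⟪e i, ψ⟫_ℂ) → ψ = 0

/-- The product `R S` is injective, so it suffices to compare `R S A B x` with `R S B A x`. With `R
A = 1 + z R` and `S B = 1 + w S` on the domains, both become the same expression in `R` and `S`. -/
theorem CommutatorVanishes.of_commute_isResolvent {A B : K →ₗ.[ℂ] K} {z w : ℂ} {R S : K →L[ℂ] K}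
    (hR : IsResolvent A z R) (hS : IsResolvent B w S) (hRS : Commute R S) :
    CommutatorVanishes A B := by
  intro x hA hB hBA hAB
  have hinj : ∀ v, R (S v) = 0 → v = 0 := by
    intro v hv
    obtain ⟨h1, h2⟩ := hR.1 (S v)
    obtain ⟨h3, h4⟩ := hS.1 v
    have h5 : S v = 0 := by
      rw [← h2]
      have : (⟨R (S v), h1⟩ : A.domain) = 0 := Subtype.ext hv
      rw [this, hv]
      simp
    rw [← h4]
    have : (⟨S v, h3⟩ : B.domain) = 0 := Subtype.ext h5
    rw [this, h5]
    simp
  have hcomm : ∀ v, S (R v) = R (S v) := fun v => (DFunLike.congr_fun hRS.eq v).symm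
  have hRx : R (A ⟨x, hA⟩) = x + z • R x := by
    have := hR.2 ⟨x, hA⟩
    rw [map_sub, map_smul] at this
    exact sub_eq_iff_eq_add.mp this
  have hSx : S (B ⟨x, hB⟩) = x + w • S x := by
    have := hS.2 ⟨x, hB⟩
    rw [map_sub, map_smul] at this
    exact sub_eq_iff_eq_add.mp this
  have hRB : R (A ⟨B ⟨x, hB⟩, hAB⟩) = B ⟨x, hB⟩ + z • R (B ⟨x, hB⟩) := by
    have := hR.2 ⟨B ⟨x, hB⟩, hAB⟩
    rw [map_sub, map_smul] at this
    exact sub_eq_iff_eq_add.mp this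
  have hSA : S (B ⟨A ⟨x, hA⟩, hBA⟩) = A ⟨x, hA⟩ + w • S (A ⟨x, hA⟩) := by
    have := hS.2 ⟨A ⟨x, hA⟩, hBA⟩
    rw [map_sub, map_smul] at this
    exact sub_eq_iff_eq_add.mp this
  rw [← sub_eq_zero]
  apply hinj
  rw [map_sub, map_sub, ← hcomm (A _), hRB, hSA]
  simp only [map_add, map_smul, hSx, hRx, hcomm, ← hcomm (A ⟨x, hA⟩)]
  module

/-! ### Resolvents, self-adjointness and commutation from a core -/

variable [CompleteSpace K]

theorem Submodule.dense_of_inner_eq_zero {S : Submodule ℂ K}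
    (h : ∀ ψ : K, (∀ x ∈ S, ⟪x, ψ⟫_ℂ = 0) → ψ = 0) : Dense (S : Set K) := by
  rw [Submodule.dense_iff_topologicalClosure_eq_top, Submodule.topologicalClosure_eq_top_iff,
    Submodule.eq_bot_iff]
  exact fun ψ hψ => h ψ ((Submodule.mem_orthogonal S ψ).mp hψ)

/-- The map `A - z`, read as a bounded operator `T` on the complete space `A.graph`, is bounded
below, so its range is closed; the deficiency condition makes the range dense. -/
theorem HasSelfAdjointCore.exists_isResolvent {ι : Type*} {A : K →ₗ.[ℂ] K} {e q : ι → K}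
    (hA : HasSelfAdjointCore A e q) {z : ℂ} (hz : z.im ≠ 0) : ∃ R : K →L[ℂ] K, IsResolvent A z R := by
  have hcomplete : CompleteSpace A.graph := hA.isClosed.completeSpace_coe
  let T : A.graph →L[ℂ] K :=
    (ContinuousLinearMap.snd ℂ K K - z • ContinuousLinearMap.fst ℂ K K).comp A.graph.subtypeL
  have hT : ∀ x : A.graph, T x = x.1.2 - z • x.1.1 := fun x => rfl
  have hb : ∀ x : A.graph, |z.im| * ‖x.1.1‖ ≤ ‖T x‖ := fun x =>
    im_mul_norm_le_norm_sub_smul z (hA.symm x.1 x.2 x.1 x.2)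
  have hz' : 0 < |z.im| := abs_pos.mpr hz
  obtain ⟨C, hC⟩ : ∃ C : NNReal, ∀ x : A.graph, ‖x‖ ≤ C * ‖T x‖ := by
    have hC0 : 0 ≤ 1 + (1 + ‖z‖) / |z.im| := by positivity
    refine ⟨⟨_, hC0⟩, fun x => ?_⟩
    have h1 : ‖x.1.1‖ ≤ ‖T x‖ / |z.im| := by
      rw [le_div_iff₀ hz', mul_comm]; exact hb x
    have h2 : ‖x.1.2‖ ≤ ‖T x‖ + ‖z‖ * ‖x.1.1‖ := by
      have h3 : x.1.2 = T x + z • x.1.1 := by rw [hT]; abel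
      rw [h3, ← norm_smul]
      exact norm_add_le _ _
    have h4 : 0 ≤ ‖T x‖ := norm_nonneg _
    have h5 : (1 + (1 + ‖z‖) / |z.im|) * ‖T x‖
        = ‖T x‖ + ‖T x‖ / |z.im| + ‖z‖ * (‖T x‖ / |z.im|) := by ring
    have h6 : ‖z‖ * ‖x.1.1‖ ≤ ‖z‖ * (‖T x‖ / |z.im|) := by gcongr
    have h7 : 0 ≤ ‖T x‖ / |z.im| := by positivity
    have h8 : 0 ≤ ‖z‖ * (‖T x‖ / |z.im|) := by positivity
    change ‖x.1‖ ≤ (1 + (1 + ‖z‖) / |z.im|) * ‖T x‖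
    rw [h5, Prod.norm_def]
    exact max_le (by linarith) (by linarith)
  have hanti : AntilipschitzWith C T := T.antilipschitz_of_bound hC
  have hclosed : IsClosed (Set.range T) := hanti.isClosed_range T.uniformContinuous
  have hdense : Dense (T.range : Set K) := by
    refine Submodule.dense_of_inner_eq_zero fun ψ hψ => ?_
    -- The inner product is conjugate linear on the left, so orthogonality to `q i - z e i` is the
    -- deficiency equation at `conj z`.
    refine hA.deficiency (conj z) ψ (by simpa using hz) fun i => ?_
    have := hψ (T ⟨(e i, q i), hA.mem_graph i⟩) ⟨_, rfl⟩
    rw [hT, inner_sub_left, inner_smul_left] at this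
    exact sub_eq_zero.mp this
  have hrange : T.range = ⊤ := by
    rw [← SetLike.coe_set_eq, Submodule.top_coe, ← hdense.closure_eq]
    exact hclosed.closure_eq.symm
  have hker : T.ker = ⊥ := LinearMap.ker_eq_bot.mpr hanti.injective
  let Φ := ContinuousLinearEquiv.ofBijective T hker hrange
  have hΦ : ∀ x, T (Φ.symm x) = x := fun x => Φ.apply_symm_apply x
  have hΦ' : ∀ x, Φ.symm (T x) = x := fun x => Φ.symm_apply_apply x
  refine ⟨((ContinuousLinearMap.fst ℂ K K).comp A.graph.subtypeL).comp
    (Φ.symm : K →L[ℂ] A.graph), fun x => ?_, fun x => ?_⟩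
  · obtain ⟨hx, hx'⟩ := LinearPMap.apply_eq_of_mem_graph (Φ.symm x).2
    refine ⟨hx, ?_⟩
    have h1 := hΦ x
    rw [hT] at h1
    change A ⟨(Φ.symm x).1.1, hx⟩ - z • (Φ.symm x).1.1 = x
    rw [hx', h1]
  · change (Φ.symm (A x - z • (x : K))).1.1 = x
    have h1 : A x - z • (x : K) = T ⟨((x : K), A x), A.mem_graph x⟩ := rfl
    rw [h1, hΦ']

theorem isSelfAdjoint_of_isResolvent {A : K →ₗ.[ℂ] K} (hsymm : IsSymmetricGraph A.graph)
    (hdense : Dense (A.domain : Set K)) {z : ℂ} {R S : K →L[ℂ] K} (hR : IsResolvent A z R)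
    (hS : IsResolvent A (conj z) S) : IsSelfAdjoint A := by
  have hle : A ≤ A.adjoint := LinearPMap.IsFormalAdjoint.le_adjoint hdense fun x y =>
    hsymm _ (A.mem_graph x) _ (A.mem_graph y)
  rw [LinearPMap.isSelfAdjoint_def]
  refine (LinearPMap.eq_of_le_of_domain_eq hle (le_antisymm hle.1 fun y hy => ?_)).symm
  obtain ⟨hx, hx'⟩ := hR.1 (A.adjoint ⟨y, hy⟩ - z • y)
  set x := R (A.adjoint ⟨y, hy⟩ - z • y)
  -- By the choice of `x`, `(A* - z) y = (A - z) x`. Writing `y - x = (A - conj z) w` and moving `A`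
  -- across gives `‖y - x‖² = ⟪(A* - z) y - (A - z) x, w⟫ = 0`.
  suffices y - x = 0 by rw [sub_eq_zero.mp this]; exact hx
  obtain ⟨hw, hw'⟩ := hS.1 (y - x)
  set w := S (y - x)
  have hadj := LinearPMap.adjoint_isFormalAdjoint hdense ⟨y, hy⟩ ⟨w, hw⟩
  have hxw := hsymm _ (A.mem_graph ⟨x, hx⟩) _ (A.mem_graph ⟨w, hw⟩)
  simp only at hadj hxw
  rw [← inner_self_eq_zero (𝕜 := ℂ)]
  nth_rewrite 2 [← hw']
  rw [inner_sub_right, inner_smul_right, inner_sub_left, inner_sub_left, ← hadj, ← hxw]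
  have h3 : A.adjoint ⟨y, hy⟩ = A ⟨x, hx⟩ - z • x + z • y := by rw [hx']; abel
  rw [h3, inner_add_left, inner_sub_left, inner_smul_left, inner_smul_left]
  ring

theorem HasSelfAdjointCore.dense_domain {ι : Type*} {A : K →ₗ.[ℂ] K} {e q : ι → K}
    (hA : HasSelfAdjointCore A e q) : Dense (A.domain : Set K) :=
  Submodule.dense_of_inner_eq_zero fun ψ hψ => hA.total ψ fun i =>
    hψ _ (LinearPMap.apply_eq_of_mem_graph (hA.mem_graph i)).1

/-- The difference of `R V (q i - z e i)` and `V (e i)` satisfies the deficiency equation at `z`,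
hence vanishes. So `R V = V R` on the vectors `q i - z e i`, whose span is dense by the deficiency
condition at `conj z`. Nothing is assumed about how `V` acts on the domain of `A`. -/
theorem HasSelfAdjointCore.commute_of_isResolvent {ι : Type*} {A : K →ₗ.[ℂ] K} {e q : ι → K}
    (hA : HasSelfAdjointCore A e q) {z : ℂ} (hz : z.im ≠ 0) {R : K →L[ℂ] K}
    (hR : IsResolvent A z R) {V : K →L[ℂ] K} (hV : ∀ i j, ⟪q j, V (e i)⟫_ℂ = ⟪e j, V (q i)⟫_ℂ) :
    Commute R V := by
  have hgen : ∀ i, R (V (q i - z • e i)) = V (R (q i - z • e i)) := by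
    intro i
    obtain ⟨hi, hi'⟩ := LinearPMap.apply_eq_of_mem_graph (hA.mem_graph i)
    have h1 : R (q i - z • e i) = e i := by
      have := hR.2 ⟨e i, hi⟩
      rwa [hi'] at this
    rw [h1, ← sub_eq_zero]
    refine hA.deficiency z _ hz fun j => ?_
    obtain ⟨hx, hx'⟩ := hR.1 (V (q i - z • e i))
    set x := R (V (q i - z • e i))
    have h2 := hA.symm _ (hA.mem_graph j) _ (A.mem_graph ⟨x, hx⟩)
    simp only at h2
    have h3 : A ⟨x, hx⟩ = V (q i) - z • V (e i) + z • x := by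
      rw [← map_smul, ← map_sub, ← hx']; abel
    rw [inner_sub_right, inner_sub_right, h2, h3, hV, inner_add_right, inner_sub_right,
      inner_smul_right, inner_smul_right]
    ring
  have hdense : Dense (Submodule.span ℂ (Set.range fun i => q i - z • e i) : Set K) := by
    refine Submodule.dense_of_inner_eq_zero fun ψ hψ => ?_
    refine hA.deficiency (conj z) ψ (by simpa using hz) fun i => ?_
    have := hψ _ (Submodule.subset_span ⟨i, rfl⟩)
    simp only [inner_sub_left, inner_smul_left] at this
    exact sub_eq_zero.mp this
  refine ContinuousLinearMap.ext_on hdense ?_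
  rintro _ ⟨i, rfl⟩
  exact hgen i

/-! ### Conjugation by unitaries -/

theorem IsSymmetricGraph.unitaryConj {A : K →ₗ.[ℂ] K} (hA : IsSymmetricGraph A.graph)
    (V : unitary (K →L[ℂ] K)) : IsSymmetricGraph (unitaryConj V A).graph := by
  rintro ⟨x, x'⟩ hxg ⟨y, y'⟩ hyg
  obtain ⟨hx, rfl⟩ := LinearPMap.apply_eq_of_mem_graph hxg
  obtain ⟨hy, rfl⟩ := LinearPMap.apply_eq_of_mem_graph hyg
  change ⟪star (V : K →L[ℂ] K) (A ⟨V.1 x, hx⟩), y⟫_ℂ = ⟪x, star (V : K →L[ℂ] K) (A ⟨V.1 y, hy⟩)⟫_ℂ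
  rw [ContinuousLinearMap.star_eq_adjoint, ContinuousLinearMap.adjoint_inner_left,
    ContinuousLinearMap.adjoint_inner_right]
  exact hA _ (A.mem_graph ⟨V.1 x, hx⟩) _ (A.mem_graph ⟨V.1 y, hy⟩)

theorem unitary_apply_star_apply (V : unitary (K →L[ℂ] K)) (x : K) :
    (V : K →L[ℂ] K) (star (V : K →L[ℂ] K) x) = x :=
  DFunLike.congr_fun (Unitary.mul_star_self_of_mem V.2) x

theorem unitary_star_apply_apply (V : unitary (K →L[ℂ] K)) (x : K) :
    star (V : K →L[ℂ] K) ((V : K →L[ℂ] K) x) = x :=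
  DFunLike.congr_fun (Unitary.star_mul_self_of_mem V.2) x

theorem IsResolvent.unitaryConj {A : K →ₗ.[ℂ] K} {z : ℂ} {R : K →L[ℂ] K} (hR : IsResolvent A z R)
    (V : unitary (K →L[ℂ] K)) :
    IsResolvent (unitaryConj V A) z (star (V : K →L[ℂ] K) * R * (V : K →L[ℂ] K)) := by
  refine ⟨fun x => ?_, fun x => ?_⟩
  · obtain ⟨h, h'⟩ := hR.1 ((V : K →L[ℂ] K) x)
    have hV : (V : K →L[ℂ] K) (star (V : K →L[ℂ] K) (R ((V : K →L[ℂ] K) x))) =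
        R ((V : K →L[ℂ] K) x) := unitary_apply_star_apply V _
    have hmem : (star (V : K →L[ℂ] K) * R * (V : K →L[ℂ] K)) x ∈ (_root_.unitaryConj V A).domain := by
      change (V : K →L[ℂ] K) (star (V : K →L[ℂ] K) (R ((V : K →L[ℂ] K) x))) ∈ A.domain
      rw [hV]; exact h
    refine ⟨hmem, ?_⟩
    change star (V : K →L[ℂ] K) (A ⟨(V : K →L[ℂ] K) (star (V : K →L[ℂ] K) (R ((V : K →L[ℂ] K) x))),
      hmem⟩) - z • star (V : K →L[ℂ] K) (R ((V : K →L[ℂ] K) x)) = x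
    have h2 : A ⟨(V : K →L[ℂ] K) (star (V : K →L[ℂ] K) (R ((V : K →L[ℂ] K) x))), hmem⟩ =
        A ⟨R ((V : K →L[ℂ] K) x), h⟩ := by congr 1; exact Subtype.ext hV
    rw [h2, ← map_smul, ← map_sub, h', unitary_star_apply_apply]
  · have h2 := hR.2 ⟨(V : K →L[ℂ] K) x, x.2⟩
    change star (V : K →L[ℂ] K) (R ((V : K →L[ℂ] K) (star (V : K →L[ℂ] K)
      (A ⟨(V : K →L[ℂ] K) x, x.2⟩) - z • (x : K)))) = x
    rw [map_sub, map_smul, unitary_apply_star_apply, h2, unitary_star_apply_apply]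

theorem dense_domain_unitaryConj {A : K →ₗ.[ℂ] K} (hA : Dense (A.domain : Set K))
    (V : unitary (K →L[ℂ] K)) : Dense ((unitaryConj V A).domain : Set K) := by
  refine Submodule.dense_of_inner_eq_zero fun ψ hψ => ?_
  have h1 : (V : K →L[ℂ] K) ψ = 0 := by
    refine hA.eq_zero_of_inner_right ℂ fun v hv => ?_
    have := hψ (star (V : K →L[ℂ] K) v) (by
      change (V : K →L[ℂ] K) (star (V : K →L[ℂ] K) v) ∈ A.domain
      rw [unitary_apply_star_apply]; exact hv)
    rw [ContinuousLinearMap.star_eq_adjoint, ContinuousLinearMap.adjoint_inner_left] at this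
    exact this
  rw [← unitary_star_apply_apply V ψ, h1, map_zero]

/-- As `V` is unitary and commutes with `S`, `V₁* S V₁ = V₀* V* S V V₀ = V₀* S V₀`. Both resolvents
are thus conjugated by the single unitary `V₁`, which preserves commutation. -/
theorem IsResolvent.exists_commute_unitaryConj {A B : K →ₗ.[ℂ] K} {z w : ℂ} {R S : K →L[ℂ] K}
    (hR : IsResolvent A z R) (hS : IsResolvent B w S) (hRS : Commute R S)
    {V V₀ V₁ : unitary (K →L[ℂ] K)} (hV : (V₁ : K →L[ℂ] K) = (V : K →L[ℂ] K) * (V₀ : K →L[ℂ] K))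
    (hSV : Commute S (V : K →L[ℂ] K)) :
    ∃ R' S' : K →L[ℂ] K, IsResolvent (_root_.unitaryConj V₁ A) z R' ∧
      IsResolvent (_root_.unitaryConj V₀ B) w S' ∧ Commute R' S' := by
  refine ⟨_, _, hR.unitaryConj V₁, hS.unitaryConj V₀, ?_⟩
  have hS' : star (V₀ : K →L[ℂ] K) * S * V₀ = star (V₁ : K →L[ℂ] K) * S * V₁ := by
    rw [hV, star_mul]
    have h1 : star (V : K →L[ℂ] K) * (S * V) = S := by
      rw [hSV.eq, ← mul_assoc, Unitary.star_mul_self_of_mem V.2, one_mul]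
    calc star (V₀ : K →L[ℂ] K) * S * V₀
        = star (V₀ : K →L[ℂ] K) * (star (V : K →L[ℂ] K) * (S * V)) * V₀ := by rw [h1]
      _ = _ := by simp only [mul_assoc]
  rw [hS']
  have h2 : (V₁ : K →L[ℂ] K) * star (V₁ : K →L[ℂ] K) = 1 := Unitary.mul_star_self_of_mem V₁.2
  have h3 : ∀ X Y : K →L[ℂ] K, star (V₁ : K →L[ℂ] K) * X * V₁ * (star (V₁ : K →L[ℂ] K) * Y * V₁) =
      star (V₁ : K →L[ℂ] K) * (X * Y) * V₁ := by
    intro X Y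
    calc _ = star (V₁ : K →L[ℂ] K) * X * (V₁ * star (V₁ : K →L[ℂ] K)) * Y * V₁ := by
          simp only [mul_assoc]
      _ = _ := by rw [h2, mul_one]; simp only [mul_assoc]
  rw [commute_iff_eq, h3, h3, hRS.eq]

/-- `ξ` lies in the closed span of `X` if its inner products with a total family `a` agree with
those of the projections `b` of `a` to this closed span. -/
theorem Submodule.mem_topologicalClosure_span_of_inner_eq {ι : Type*} {X : Set K} {a b : ι → K}
    (ha : ∀ ψ : K, (∀ i, ⟪a i, ψ⟫_ℂ = 0) → ψ = 0)
    (hb : ∀ i, b i ∈ (Submodule.span ℂ X).topologicalClosure)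
    (hX : ∀ x ∈ X, ∀ i, ⟪x, a i⟫_ℂ = ⟪x, b i⟫_ℂ) {ξ : K} (hξ : ∀ i, ⟪b i, ξ⟫_ℂ = ⟪a i, ξ⟫_ℂ) :
    ξ ∈ (Submodule.span ℂ X).topologicalClosure := by
  set S := (Submodule.span ℂ X).topologicalClosure
  have hcomplete : CompleteSpace S := (Submodule.isClosed_topologicalClosure _).completeSpace_coe
  have hab : ∀ i, a i - b i ∈ Sᗮ := by
    intro i
    rw [Submodule.mem_orthogonal]
    intro x hx
    refine closure_minimal (t := {x | ⟪x, a i - b i⟫_ℂ = 0}) (fun x hx => ?_)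
      (isClosed_eq (by fun_prop) continuous_const) hx
    have h1 : Submodule.span ℂ X ≤ (ℂ ∙ (a i - b i))ᗮ := by
      rw [Submodule.span_le]
      intro y hy
      rw [SetLike.mem_coe, Submodule.mem_orthogonal_singleton_iff_inner_left, inner_sub_right,
        hX y hy, sub_self]
    exact Submodule.mem_orthogonal_singleton_iff_inner_left.mp (h1 hx)
  have hη : ξ - S.starProjection ξ ∈ Sᗮ := S.sub_starProjection_mem_orthogonal ξ
  -- With `P` the projection onto `S`: `⟪a, ξ - P ξ⟫ = ⟪b, ξ⟫ - ⟪b, P ξ⟫ = 0`, using the hypothesis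
  -- on `ξ`, `a - b ⟂ S` and `b ∈ S`.
  have hη0 : ξ - S.starProjection ξ = 0 := by
    refine ha _ fun i => ?_
    have h1 : ⟪b i, ξ - S.starProjection ξ⟫_ℂ = 0 :=
      Submodule.inner_right_of_mem_orthogonal (hb i) hη
    have h2 : ⟪a i - b i, S.starProjection ξ⟫_ℂ = 0 :=
      Submodule.inner_left_of_mem_orthogonal (S.starProjection_apply_mem ξ) (hab i)
    rw [inner_sub_left] at h2
    rw [inner_sub_right] at h1 ⊢
    rw [← hξ i, ← h1, sub_eq_zero.mp h2]
  rw [sub_eq_zero.mp hη0]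
  exact S.starProjection_apply_mem ξ

end UnboundedOperators

/-! ### Exponential vectors and field operators -/

section FockSpace

variable {E : Type*} [NormedAddCommGroup E] [InnerProductSpace ℂ E]

theorem eq_zero_of_inner_expVec {ψ : Fock E} (h : ∀ g : E, ⟪expVec g, ψ⟫_ℂ = 0) : ψ = 0 := by
  have hd := Submodule.dense_iff_topologicalClosure_eq_top.mpr (span_expVec_dense E)
  refine hd.eq_zero_of_inner_right ℂ fun v hv => ?_
  induction hv using Submodule.span_induction with
  | mem x hx => obtain ⟨g, rfl⟩ := hx; exact h g
  | zero => simp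
  | add x y _ _ hx hy => rw [inner_add_left, hx, hy, add_zero]
  | smul c x _ hx => rw [inner_smul_left, hx, mul_zero]

theorem eq_of_inner_expVec {ψ φ : Fock E} (h : ∀ g : E, ⟪expVec g, ψ⟫_ℂ = ⟪expVec g, φ⟫_ℂ) :
    ψ = φ := by
  rw [← sub_eq_zero]
  exact eq_zero_of_inner_expVec fun g => by rw [inner_sub_right, h, sub_self]

theorem norm_sq_expVec (f : E) : ‖expVec f‖ ^ 2 = (Complex.exp ⟪f, f⟫_ℂ).re := by
  rw [← inner_expVec, ← inner_self_eq_norm_sq (𝕜 := ℂ)]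
  rfl

theorem continuous_expVec : Continuous (expVec (E := E)) := by
  rw [continuous_iff_continuousAt]
  intro g
  rw [ContinuousAt, tendsto_iff_norm_sub_tendsto_zero]
  have h1 : ∀ f : E, ‖expVec f - expVec g‖ = Real.sqrt ((Complex.exp ⟪f, f⟫_ℂ).re
      - 2 * (Complex.exp ⟪f, g⟫_ℂ).re + (Complex.exp ⟪g, g⟫_ℂ).re) := by
    intro f
    rw [← norm_sq_expVec, ← norm_sq_expVec, ← inner_expVec]
    have := norm_sub_sq (𝕜 := ℂ) (expVec f) (expVec g)
    simp only [RCLike.re_eq_complex_re] at this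
    rw [← this, Real.sqrt_sq (norm_nonneg _)]
  simp only [h1]
  have h2 : Continuous fun f : E => Real.sqrt ((Complex.exp ⟪f, f⟫_ℂ).re
      - 2 * (Complex.exp ⟪f, g⟫_ℂ).re + (Complex.exp ⟪g, g⟫_ℂ).re) := by fun_prop
  have h3 := h2.tendsto g
  convert h3 using 2
  rw [eq_comm, Real.sqrt_eq_zero']
  linarith

theorem differentiable_inner_expVec_line (f g h : E) :
    Differentiable ℂ fun z : ℂ => ⟪expVec f, expVec (g + z • h)⟫_ℂ := by
  simp only [inner_expVec, inner_add_right, inner_smul_right]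
  fun_prop

/-- Weak holomorphy plus norm continuity gives strong holomorphy: the Cauchy integral of the
continuous curve is analytic, and by the scalar Cauchy formula it has the same inner products with
all exponential vectors as the curve itself. -/
theorem differentiable_expVec_line (g h : E) :
    Differentiable ℂ fun z : ℂ => expVec (g + z • h) := by
  intro z₀
  set G : ℂ → Fock E := fun z => expVec (g + z • h)
  have hG : Continuous G := continuous_expVec.comp (by fun_prop)
  have hps := hasFPowerSeriesOn_cauchy_integral (f := G) (c := z₀) (R := 1)
    (hG.continuousOn.circleIntegrable (by simp)) one_pos
  refine (hps.analyticAt.differentiableAt).congr_of_eventuallyEq ?_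
  filter_upwards [Metric.ball_mem_nhds z₀ one_pos] with w hw
  refine eq_of_inner_expVec fun f => ?_
  have hd := differentiable_inner_expVec_line f g h
  have hC := Complex.two_pi_I_inv_smul_circleIntegral_sub_inv_smul_of_differentiable_on_off_countable
    (s := ∅) Set.countable_empty hw hd.continuous.continuousOn fun x _ => hd x
  rw [inner_smul_right]
  refine hC.symm.trans ?_
  rw [smul_eq_mul]
  congr 1
  rw [circleIntegral, circleIntegral, ← innerSL_apply_apply,
    ← ContinuousLinearMap.intervalIntegral_comp_comm]
  · simp [G]
  · have hne : ∀ θ : ℝ, circleMap z₀ 1 θ - w ≠ 0 := fun θ h0 => by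
      rw [sub_eq_zero] at h0
      rw [Metric.mem_ball, ← h0] at hw
      simp [circleMap, dist_eq_norm] at hw
    refine Continuous.intervalIntegrable ?_ _ _
    simp only [deriv_circleMap]
    have hcm : Continuous (circleMap z₀ 1) := continuous_circleMap _ _
    have hcm0 : Continuous (circleMap 0 1) := continuous_circleMap _ _
    have hinv : Continuous fun θ : ℝ => (circleMap z₀ 1 θ - w)⁻¹ :=
      (hcm.sub continuous_const).inv₀ hne
    exact (hcm0.mul continuous_const).smul (hinv.smul (hG.comp hcm))

/-- The vector `a†(h) e(g)`, as the derivative of `z ↦ e(g + z h)` at `0`. -/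
def creationVec (h g : E) : Fock E := deriv (fun z : ℂ => expVec (g + z • h)) 0

theorem hasDerivAt_expVec_line (h g : E) (z₀ : ℂ) :
    HasDerivAt (fun z : ℂ => expVec (g + z • h)) (creationVec h (g + z₀ • h)) z₀ := by
  have h1 := (differentiable_expVec_line (g + z₀ • h) h 0).hasDerivAt
  have h2 : HasDerivAt (fun z : ℂ => z - z₀) 1 z₀ := (hasDerivAt_id z₀).sub_const z₀
  have h1' : HasDerivAt (fun z : ℂ => expVec (g + z₀ • h + z • h)) (creationVec h (g + z₀ • h))
    ((fun z : ℂ => z - z₀) z₀) := by simp only [sub_self]; exact h1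
  have h3 := HasDerivAt.scomp (h := fun z : ℂ => z - z₀) z₀ h1' h2
  rw [one_smul] at h3
  refine h3.congr_of_eventuallyEq (Filter.Eventually.of_forall fun z => ?_)
  simp only [Function.comp]
  congr 1
  rw [add_assoc, ← add_smul, add_sub_cancel]

theorem inner_expVec_creationVec (f h g : E) :
    ⟪expVec f, creationVec h g⟫_ℂ = ⟪f, h⟫_ℂ * Complex.exp ⟪f, g⟫_ℂ := by
  have h1 := hasDerivAt_expVec_line h g 0
  rw [zero_smul, add_zero] at h1
  have h2 := (innerSL ℂ (expVec f)).hasFDerivAt.comp_hasDerivAt (0 : ℂ) h1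
  have h3 : HasDerivAt (fun z : ℂ => Complex.exp (⟪f, g⟫_ℂ + z * ⟪f, h⟫_ℂ))
      (Complex.exp (⟪f, g⟫_ℂ + 0 * ⟪f, h⟫_ℂ) * (1 * ⟪f, h⟫_ℂ)) 0 :=
    (((hasDerivAt_id (0 : ℂ)).mul_const ⟪f, h⟫_ℂ).const_add ⟪f, g⟫_ℂ).cexp
  have h4 : (fun z : ℂ => Complex.exp (⟪f, g⟫_ℂ + z * ⟪f, h⟫_ℂ)) =
      (innerSL ℂ (expVec f)) ∘ fun z : ℂ => expVec (g + z • h) := by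
    funext z
    simp [inner_expVec]
  rw [h4] at h3
  have h5 := h2.unique h3
  rw [innerSL_apply_apply] at h5
  rw [h5]
  simp [mul_comm]

/-- The vector `(a(h) + a†(h)) e(g)`. -/
def fieldVec (h g : E) : Fock E := ⟪h, g⟫_ℂ • expVec g + creationVec h g

theorem inner_expVec_fieldVec (f h g : E) :
    ⟪expVec f, fieldVec h g⟫_ℂ = (⟪h, g⟫_ℂ + ⟪f, h⟫_ℂ) * Complex.exp ⟪f, g⟫_ℂ := by
  rw [fieldVec, inner_add_right, inner_smul_right, inner_expVec, inner_expVec_creationVec]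
  ring

theorem inner_fieldVec_expVec (f h g : E) :
    ⟪fieldVec h f, expVec g⟫_ℂ = (⟪h, g⟫_ℂ + ⟪f, h⟫_ℂ) * Complex.exp ⟪f, g⟫_ℂ := by
  rw [← inner_conj_symm, inner_expVec_fieldVec, map_mul, ← Complex.exp_conj, map_add,
    inner_conj_symm, inner_conj_symm, inner_conj_symm]
  ring

/-! ### Creation, annihilation and field operators on exponential vectors -/

theorem mem_graph_creation_iff (h : E) (p : Fock E × Fock E) :
    p ∈ (creation h).graph ↔ ∀ g : E, ⟪expVec g, p.2⟫_ℂ = ⟪g, h⟫_ℂ * ⟪expVec g, p.1⟫_ℂ := by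
  rw [creation, Submodule.toLinearPMap_graph_eq]
  · rfl
  · rintro ⟨x, y⟩ hxy h0
    simp only at h0
    refine eq_zero_of_inner_expVec fun g => ?_
    have := hxy g
    simp only [h0, inner_zero_right, mul_zero] at this
    exact this

theorem creationVec_mem_graph (h g : E) : (expVec g, creationVec h g) ∈ (creation h).graph := by
  rw [mem_graph_creation_iff]
  intro f
  rw [inner_expVec_creationVec, inner_expVec]

theorem dense_domain_creation (h : E) : Dense ((creation h).domain : Set (Fock E)) :=
  Submodule.dense_of_inner_eq_zero fun _ hψ => eq_zero_of_inner_expVec fun g =>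
    hψ _ (LinearPMap.apply_eq_of_mem_graph (creationVec_mem_graph h g)).1

theorem annihilation_expVec_mem_graph (h g : E) :
    (expVec g, ⟪h, g⟫_ℂ • expVec g) ∈ (annihilation h).graph := by
  have hkey : ∀ x : (creation h).domain,
      ⟪⟪h, g⟫_ℂ • expVec g, (x : Fock E)⟫_ℂ = ⟪expVec g, creation h x⟫_ℂ := by
    intro x
    have := (mem_graph_creation_iff h _).mp ((creation h).mem_graph x) g
    simp only at this
    rw [this, inner_smul_left, inner_conj_symm]
  have hmem : expVec g ∈ (annihilation h).domain :=
    (creation h).mem_adjoint_domain_of_exists _ ⟨_, hkey⟩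
  have happ : annihilation h ⟨expVec g, hmem⟩ = ⟪h, g⟫_ℂ • expVec g :=
    LinearPMap.adjoint_apply_eq (dense_domain_creation h) ⟨expVec g, hmem⟩ hkey
  rw [← happ]
  exact (annihilation h).mem_graph ⟨expVec g, hmem⟩

theorem fieldVec_mem_graph (h g : E) :
    (expVec g, fieldVec h g) ∈ (annihilation h + creation h).graph := by
  obtain ⟨h1, h1'⟩ := LinearPMap.apply_eq_of_mem_graph (annihilation_expVec_mem_graph h g)
  obtain ⟨h2, h2'⟩ := LinearPMap.apply_eq_of_mem_graph (creationVec_mem_graph h g)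
  have h3 : (annihilation h + creation h) ⟨expVec g, ⟨h1, h2⟩⟩ = fieldVec h g := by
    rw [LinearPMap.add_apply, fieldVec, ← h1', ← h2']
  rw [← h3]
  exact LinearPMap.mem_graph _ (⟨expVec g, ⟨h1, h2⟩⟩ : (annihilation h + creation h).domain)

/-- Annihilation is the adjoint of creation, so moving the sum across the inner product exchanges
its two terms. -/
theorem isSymmetricGraph_annihilation_add_creation (h : E) :
    IsSymmetricGraph (annihilation h + creation h).graph := by
  rintro ⟨x, x'⟩ hxg ⟨y, y'⟩ hyg
  obtain ⟨hx, rfl⟩ := LinearPMap.apply_eq_of_mem_graph hxg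
  obtain ⟨hy, rfl⟩ := LinearPMap.apply_eq_of_mem_graph hyg
  have hadj := LinearPMap.adjoint_isFormalAdjoint (dense_domain_creation h)
  have h1 := hadj ⟨x, hx.1⟩ ⟨y, hy.2⟩
  have h2 := hadj ⟨y, hy.1⟩ ⟨x, hx.2⟩
  simp only at h1 h2
  simp only [LinearPMap.add_apply, inner_add_left, inner_add_right]
  have h3 : ⟪creation h ⟨x, hx.2⟩, y⟫_ℂ = ⟪x, annihilation h ⟨y, hy.1⟩⟫_ℂ := by
    rw [← inner_conj_symm, ← inner_conj_symm x]
    exact congrArg _ h2.symm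
  rw [add_comm]
  exact congrArg₂ _ h3 h1

theorem total_annihilation_add_creation (h : E) (ψ : Fock E)
    (hψ : ∀ x ∈ (annihilation h + creation h).graph, ⟪x.1, ψ⟫_ℂ = 0) : ψ = 0 :=
  eq_zero_of_inner_expVec fun g => hψ (expVec g, fieldVec h g) (fieldVec_mem_graph h g)

/-- The field operator `a(h) + a†(h)`, closed. -/
def fieldOp (h : E) : Fock E →ₗ.[ℂ] Fock E := (annihilation h + creation h).closure

theorem graph_fieldOp (h : E) :
    (fieldOp h).graph = (annihilation h + creation h).graph.topologicalClosure :=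
  (isSymmetricGraph_annihilation_add_creation h).graph_closure (total_annihilation_add_creation h)

theorem isSymmetricGraph_fieldOp (h : E) : IsSymmetricGraph (fieldOp h).graph := by
  rw [graph_fieldOp]
  exact (isSymmetricGraph_annihilation_add_creation h).topologicalClosure

theorem fieldVec_mem_graph_fieldOp (h g : E) : (expVec g, fieldVec h g) ∈ (fieldOp h).graph := by
  rw [graph_fieldOp]
  exact Submodule.le_topologicalClosure _ (fieldVec_mem_graph h g)

/-! ### Weyl orbits of exponential vectors -/

/-- The exponent in `exp (i l (a(h) + a†(h))) e(g) = exp (weylExponent h l g) e(g + i l h)`. -/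
def weylExponent (h : E) (l : ℝ) (g : E) : ℂ :=
  -(l : ℂ) ^ 2 / 2 * ⟪h, h⟫_ℂ + Complex.I * l * ⟪h, g⟫_ℂ

/-- The vector `exp (i l (a(h) + a†(h))) e(g)`. -/
def weylVec (h : E) (l : ℝ) (g : E) : Fock E :=
  Complex.exp (weylExponent h l g) • expVec (g + (Complex.I * l) • h)

theorem weylVec_zero (h g : E) : weylVec h 0 g = expVec g := by
  simp [weylVec, weylExponent]

theorem inner_weylVec_weylVec (h : E) (l : ℝ) (f g : E) :
    ⟪weylVec h l f, weylVec h l g⟫_ℂ = ⟪expVec f, expVec g⟫_ℂ := by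
  rw [weylVec, weylVec, inner_smul_left, inner_smul_right, inner_expVec, inner_expVec,
    ← Complex.exp_conj, ← Complex.exp_add, ← Complex.exp_add]
  congr 1
  simp only [weylExponent, map_add, map_mul, map_neg, map_div₀, map_pow, inner_conj_symm,
    inner_add_left, inner_add_right, inner_smul_left, inner_smul_right, Complex.conj_I,
    Complex.conj_ofReal, map_ofNat]
  linear_combination (-(l : ℂ) ^ 2 * ⟪h, h⟫_ℂ) * Complex.I_sq

theorem inner_weylVec_expVec (h : E) (l : ℝ) (f g : E) :
    ⟪weylVec h (-l) f, expVec g⟫_ℂ = ⟪expVec f, weylVec h l g⟫_ℂ := by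
  rw [weylVec, weylVec, inner_smul_left, inner_smul_right, inner_expVec, inner_expVec,
    ← Complex.exp_conj, ← Complex.exp_add, ← Complex.exp_add]
  congr 1
  simp only [weylExponent, map_add, map_mul, map_neg, map_div₀, map_pow, inner_conj_symm,
    inner_add_left, inner_add_right, inner_smul_left, inner_smul_right, Complex.conj_I,
    Complex.conj_ofReal, map_ofNat, Complex.ofReal_neg]
  ring

/-- The scalar factor contributes `i ⟪h, g + i l h⟫`, the annihilation eigenvalue at the shifted
argument, and the shift contributes the creation part. This identifies the field operator as the
generator of the orbit. -/
theorem hasDerivAt_weylVec (h : E) (l : ℝ) (g : E) :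
    HasDerivAt (fun l : ℝ => weylVec h l g)
      (Complex.I • Complex.exp (weylExponent h l g) • fieldVec h (g + (Complex.I * l) • h)) l := by
  have hl : HasDerivAt (fun l : ℝ => (l : ℂ)) 1 l := Complex.ofRealCLM.hasDerivAt
  have hIl : HasDerivAt (fun l : ℝ => Complex.I * (l : ℂ)) Complex.I l := by
    simpa using hl.const_mul Complex.I
  have h1 := (hasDerivAt_expVec_line h g (Complex.I * l)).scomp l hIl
  have h2 : HasDerivAt (fun l : ℝ => weylExponent h l g)
      (-(l : ℂ) * ⟪h, h⟫_ℂ + Complex.I * ⟪h, g⟫_ℂ) l := by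
    have := (((hl.pow 2).neg.div_const 2).mul_const ⟪h, h⟫_ℂ).add (hIl.mul_const ⟪h, g⟫_ℂ)
    refine this.congr_deriv ?_
    push_cast
    ring
  have h3 := h2.cexp.smul h1
  refine h3.congr_deriv ?_
  rw [fieldVec, inner_add_right, inner_smul_right]
  simp only [Function.comp]
  match_scalars
  · ring
  · linear_combination (-Complex.exp (weylExponent h l g) * (l : ℂ) * ⟪h, h⟫_ℂ) * Complex.I_sq

/-- The canonical commutation relation in weak form: translation by `i l h` changes the field of `k`
by a multiple of `Im ⟪h, k⟫`, which vanishes here. -/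
theorem inner_weylVec_fieldVec {h k : E} (hhk : ⟪h, k⟫_ℂ = ⟪k, h⟫_ℂ) (l : ℝ) (f g : E) :
    ⟪weylVec h (-l) f, fieldVec k g⟫_ℂ = ⟪fieldVec k f, weylVec h l g⟫_ℂ := by
  have h1 := inner_weylVec_expVec h l f g
  simp only [weylVec, inner_smul_left, inner_smul_right, inner_expVec] at h1
  simp only [weylVec, inner_smul_left, inner_smul_right, inner_expVec_fieldVec,
    inner_fieldVec_expVec]
  rw [mul_left_comm, h1, mul_left_comm]
  congr 2
  simp only [inner_add_left, inner_add_right, inner_smul_left, inner_smul_right, map_mul,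
    Complex.conj_I, Complex.conj_ofReal, hhk, Complex.ofReal_neg, map_neg]
  ring

end FockSpace

/-! ### Tensor products and quadratures -/

section TensorProducts

variable {E F : Type*} [NormedAddCommGroup E] [InnerProductSpace ℂ E]
  [NormedAddCommGroup F] [InnerProductSpace ℂ F]

/-- `ψ ↦ u ⊗ ψ` as a bounded operator. -/
def htmulRight (F : Type*) [NormedAddCommGroup F] [InnerProductSpace ℂ F] (u : E) :
    F →L[ℂ] HTensor E F :=
  (UniformSpace.Completion.toComplL (𝕜 := ℂ) (E := E ⊗[ℂ] F)).comp (TensorProduct.mkL ℂ E F u)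

/-- `u ↦ u ⊗ ψ` as a bounded operator. -/
def htmulLeft (E : Type*) [NormedAddCommGroup E] [InnerProductSpace ℂ E] (ψ : F) :
    E →L[ℂ] HTensor E F :=
  (UniformSpace.Completion.toComplL (𝕜 := ℂ) (E := E ⊗[ℂ] F)).comp
    ((TensorProduct.mkL ℂ E F).flip ψ)

theorem htmulRight_apply (u : E) (ψ : F) : htmulRight F u ψ = htmul u ψ := rfl

theorem htmulLeft_apply (u : E) (ψ : F) : htmulLeft E ψ u = htmul u ψ := rfl

theorem inner_htmul (u v : E) (ψ φ : F) :
    ⟪htmul u ψ, htmul v φ⟫_ℂ = ⟪u, v⟫_ℂ * ⟪ψ, φ⟫_ℂ := by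
  rw [htmul, htmul, UniformSpace.Completion.inner_coe, TensorProduct.inner_tmul]

theorem tensorId_htmul (X : E →L[ℂ] E) (u : E) (ψ : F) :
    tensorId F X (htmul u ψ) = htmul (X u) ψ := by
  rw [tensorId, htmul, ContinuousLinearMap.completion_apply_coe]
  rfl

theorem htmul_smul (c : ℂ) (u : E) (ψ : F) : htmul u (c • ψ) = c • htmul u ψ :=
  (htmulRight F u).map_smul c ψ

theorem eq_zero_of_inner_htmul {x : HTensor E F} (h : ∀ u ψ, ⟪htmul u ψ, x⟫_ℂ = 0) : x = 0 := by
  have hd : DenseRange ((↑) : E ⊗[ℂ] F → HTensor E F) := UniformSpace.Completion.denseRange_coe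
  refine hd.eq_zero_of_inner_right ℂ fun t => ?_
  induction t using TensorProduct.induction_on with
  | zero => rw [UniformSpace.Completion.coe_zero, inner_zero_left]
  | tmul u ψ => exact h u ψ
  | add a b ha hb => rw [UniformSpace.Completion.coe_add, inner_add_left, ha, hb, add_zero]

theorem dense_span_htmul :
    Dense (Submodule.span ℂ {x : HTensor E F | ∃ u ψ, x = htmul u ψ} : Set (HTensor E F)) :=
  Submodule.dense_of_inner_eq_zero fun _ hψ => eq_zero_of_inner_htmul fun u φ =>
    hψ _ (Submodule.subset_span ⟨u, φ, rfl⟩)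

theorem inner_htmul_tensorId [CompleteSpace E] (X : E →L[ℂ] E) (u : E) (ψ : F) (x : HTensor E F) :
    ⟪htmul u ψ, tensorId F X x⟫_ℂ = ⟪htmul (X.adjoint u) ψ, x⟫_ℂ := by
  have h : (innerSL ℂ (htmul u ψ)).comp (tensorId F X) = innerSL ℂ (htmul (X.adjoint u) ψ) := by
    refine ContinuousLinearMap.ext_on dense_span_htmul ?_
    rintro _ ⟨v, φ, rfl⟩
    simp only [ContinuousLinearMap.comp_apply, innerSL_apply_apply, tensorId_htmul, inner_htmul,
      ContinuousLinearMap.adjoint_inner_left]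
  exact DFunLike.congr_fun h x

/-- Equal Gram matrices make the map on linear combinations isometric, hence well defined and
extendable from the dense span. -/
theorem exists_continuousLinearMap_of_inner_eq {K ι : Type*} [NormedAddCommGroup K]
    [InnerProductSpace ℂ K] [CompleteSpace K] {v w : ι → K}
    (htot : ∀ ψ : K, (∀ i, ⟪v i, ψ⟫_ℂ = 0) → ψ = 0) (h : ∀ i j, ⟪w i, w j⟫_ℂ = ⟪v i, v j⟫_ℂ) :
    ∃ T : K →L[ℂ] K, ∀ i, T (v i) = w i := by
  have hnorm : ∀ x : ι →₀ ℂ, ‖Finsupp.linearCombination ℂ w x‖ ≤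
      1 * ‖Finsupp.linearCombination ℂ v x‖ := by
    intro x
    rw [one_mul]
    refine le_of_eq ((sq_eq_sq₀ (norm_nonneg _) (norm_nonneg _)).mp ?_)
    rw [← inner_self_eq_norm_sq (𝕜 := ℂ), ← inner_self_eq_norm_sq (𝕜 := ℂ)]
    congr 1
    simp only [Finsupp.linearCombination_apply, Finsupp.sum, sum_inner, inner_sum, inner_smul_left,
      inner_smul_right, h]
  have hdense : DenseRange (Finsupp.linearCombination ℂ v) := by
    have : Dense (LinearMap.range (Finsupp.linearCombination ℂ v) : Set K) :=
      Submodule.dense_of_inner_eq_zero fun ψ hψ => htot ψ fun i =>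
        hψ _ ⟨Finsupp.single i 1, by simp⟩
    rwa [LinearMap.coe_range] at this
  refine ⟨(Finsupp.linearCombination ℂ w).extendOfNorm (Finsupp.linearCombination ℂ v), fun i => ?_⟩
  have := LinearMap.extendOfNorm_eq hdense ⟨1, hnorm⟩ (Finsupp.single i 1)
  simpa using this

end TensorProducts

/-! ### Field operators on the tensor product and their commutation -/

section Quadratures

variable {𝔥 E : Type*} [NormedAddCommGroup 𝔥] [InnerProductSpace ℂ 𝔥]
  [NormedAddCommGroup E] [InnerProductSpace ℂ E]

theorem eq_zero_of_inner_htmul_expVec {x : HTensor 𝔥 (Fock E)}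
    (h : ∀ u g, ⟪htmul u (expVec g), x⟫_ℂ = 0) : x = 0 := by
  refine eq_zero_of_inner_htmul fun u ψ => ?_
  have hd := Submodule.dense_iff_topologicalClosure_eq_top.mpr (span_expVec_dense E)
  have h0 : (innerSL ℂ x).comp (htmulRight (Fock E) u) = 0 := by
    refine ContinuousLinearMap.ext_on hd ?_
    rintro _ ⟨g, rfl⟩
    simp only [ContinuousLinearMap.comp_apply, innerSL_apply_apply, htmulRight_apply,
      zero_apply]
    rw [← inner_conj_symm, h, map_zero]
  have := DFunLike.congr_fun h0 ψ
  simp only [ContinuousLinearMap.comp_apply, innerSL_apply_apply, htmulRight_apply,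
      zero_apply] at this
  rw [← inner_conj_symm, this, map_zero]

theorem eq_of_inner_htmul_expVec {x y : HTensor 𝔥 (Fock E)}
    (h : ∀ u g, ⟪htmul u (expVec g), x⟫_ℂ = ⟪htmul u (expVec g), y⟫_ℂ) : x = y := by
  rw [← sub_eq_zero]
  exact eq_zero_of_inner_htmul_expVec fun u g => by rw [inner_sub_right, h, sub_self]

theorem dense_span_htmul_expVec :
    Dense (Submodule.span ℂ (Set.range fun p : 𝔥 × E => htmul p.1 (expVec p.2)) :
      Set (HTensor 𝔥 (Fock E))) :=
  Submodule.dense_of_inner_eq_zero fun _ hψ => eq_zero_of_inner_htmul_expVec fun u g =>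
    hψ _ (Submodule.subset_span ⟨(u, g), rfl⟩)

/-- A deficiency vector `ψ` pairs with the Weyl orbit as `P l = exp (-i z l) P 0`. For non-real `z`
this grows exponentially in one direction, while the orbit has constant norm; so `P 0 = 0`. -/
theorem eq_zero_of_inner_fieldVec (h : E) {z : ℂ} (hz : z.im ≠ 0) {ψ : HTensor 𝔥 (Fock E)}
    (hψ : ∀ (u : 𝔥) (g : E), ⟪htmul u (fieldVec h g), ψ⟫_ℂ = z * ⟪htmul u (expVec g), ψ⟫_ℂ) :
    ψ = 0 := by
  refine eq_zero_of_inner_htmul_expVec fun u g => ?_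
  set P : ℝ → ℂ := fun l => ⟪htmul u (weylVec h l g), ψ⟫_ℂ
  have hP : ∀ l, HasDerivAt P (-Complex.I * z * P l) l := by
    intro l
    have h1 := (htmulRight (Fock E) u).restrictScalars ℝ |>.hasFDerivAt.comp_hasDerivAt l
      (hasDerivAt_weylVec h l g)
    have h2 := h1.inner ℂ (hasDerivAt_const l ψ)
    refine h2.congr_deriv ?_
    simp only [Function.comp, ContinuousLinearMap.coe_restrictScalars', htmulRight_apply,
      inner_zero_right, zero_add, htmul_smul, inner_smul_left, hψ, P, weylVec, Complex.conj_I]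
    ring
  have hconst : ∀ l, P l * Complex.exp (Complex.I * z * l) = P 0 := by
    intro l
    have hd : ∀ l : ℝ, HasDerivAt (fun l : ℝ => P l * Complex.exp (Complex.I * z * l)) 0 l := by
      intro l
      have hl : HasDerivAt (fun l : ℝ => (l : ℂ)) 1 l := Complex.ofRealCLM.hasDerivAt
      refine ((hP l).mul (hl.const_mul (Complex.I * z)).cexp).congr_deriv ?_
      ring
    have := is_const_of_deriv_eq_zero (fun l => (hd l).differentiableAt) (fun l => (hd l).deriv) l 0
    simpa using this
  have hbound : ∀ l, ‖P l‖ ≤ ‖htmul u (expVec g)‖ * ‖ψ‖ := by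
    intro l
    refine (norm_inner_le_norm _ _).trans (le_of_eq ?_)
    congr 1
    refine (sq_eq_sq₀ (norm_nonneg _) (norm_nonneg _)).mp ?_
    rw [← inner_self_eq_norm_sq (𝕜 := ℂ), ← inner_self_eq_norm_sq (𝕜 := ℂ), inner_htmul,
      inner_htmul, inner_weylVec_weylVec]
  have hle : ∀ m : ℝ, ‖P 0‖ ≤ ‖htmul u (expVec g)‖ * ‖ψ‖ * Real.exp (-m) := by
    intro m
    -- The time `m / z.im` makes the exponent have real part `-m`, whatever the sign of `z.im`.
    rw [← hconst (m / z.im), norm_mul, Complex.norm_exp]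
    have : (Complex.I * z * ((m / z.im : ℝ) : ℂ)).re = -m := by
      rw [Complex.re_mul_ofReal]
      simp only [Complex.mul_re, Complex.I_re, Complex.I_im, zero_mul, one_mul, zero_sub]
      field_simp
    rw [this]
    gcongr
    exact hbound _
  have hlim : Filter.Tendsto (fun m : ℝ => ‖htmul u (expVec g)‖ * ‖ψ‖ * Real.exp (-m))
      Filter.atTop (nhds (‖htmul u (expVec g)‖ * ‖ψ‖ * 0)) :=
    Real.tendsto_exp_neg_atTop_nhds_zero.const_mul _
  rw [mul_zero] at hlim
  have h0 : ‖P 0‖ ≤ 0 := ge_of_tendsto' hlim hle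
  have h1 : P 0 = 0 := norm_le_zero_iff.mp h0
  simpa [P, weylVec_zero] using h1

/-- The graph of `u ⊗ ψ ↦ u ⊗ A ψ` on the algebraic tensor product. -/
def algGraph (𝔥 : Type*) [NormedAddCommGroup 𝔥] [InnerProductSpace ℂ 𝔥]
    {F : Type*} [NormedAddCommGroup F] [InnerProductSpace ℂ F] (A : F →ₗ.[ℂ] F) :
    Submodule ℂ (HTensor 𝔥 F × HTensor 𝔥 F) :=
  Submodule.span ℂ {p : HTensor 𝔥 F × HTensor 𝔥 F |
      ∃ (u : 𝔥) (ψ : A.domain), p = (htmul u (ψ : F), htmul u (A ψ))}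

theorem isSymmetricGraph_algGraph {F : Type*} [NormedAddCommGroup F] [InnerProductSpace ℂ F]
    {A : F →ₗ.[ℂ] F} (hA : IsSymmetricGraph A.graph) : IsSymmetricGraph (algGraph 𝔥 A) := by
  intro x hx y hy
  induction hx using Submodule.span_induction with
  | mem x hx =>
    obtain ⟨u, ψ, rfl⟩ := hx
    induction hy using Submodule.span_induction with
    | mem y hy =>
      obtain ⟨v, φ, rfl⟩ := hy
      simp only [inner_htmul]
      congr 1
      exact hA _ (A.mem_graph ψ) _ (A.mem_graph φ)
    | zero => simp
    | add a b _ _ ha hb =>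
      rw [Prod.fst_add, Prod.snd_add, inner_add_right, inner_add_right, ha, hb]
    | smul c a _ ha => rw [Prod.smul_fst, Prod.smul_snd, inner_smul_right, inner_smul_right, ha]
  | zero => simp
  | add a b _ _ ha hb => rw [Prod.fst_add, Prod.snd_add, inner_add_left, inner_add_left, ha, hb]
  | smul c a _ ha => rw [Prod.smul_fst, Prod.smul_snd, inner_smul_left, inner_smul_left, ha]

theorem mem_algGraph_fieldOp (h : E) (u : 𝔥) (g : E) :
    (htmul u (expVec g), htmul u (fieldVec h g)) ∈ algGraph 𝔥 (fieldOp h) := by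
  obtain ⟨hg, hg'⟩ := LinearPMap.apply_eq_of_mem_graph (fieldVec_mem_graph_fieldOp h g)
  exact Submodule.subset_span ⟨u, ⟨expVec g, hg⟩, by rw [hg']⟩

theorem total_algGraph_fieldOp (h : E) (ψ : HTensor 𝔥 (Fock E))
    (hψ : ∀ x ∈ algGraph 𝔥 (fieldOp h), ⟪x.1, ψ⟫_ℂ = 0) : ψ = 0 :=
  eq_zero_of_inner_htmul_expVec fun u g => hψ _ (mem_algGraph_fieldOp h u g)

theorem graph_idTensor_fieldOp (h : E) :
    (idTensor 𝔥 (fieldOp h)).graph = (algGraph 𝔥 (fieldOp h)).topologicalClosure := by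
  have hs := isSymmetricGraph_algGraph (𝔥 := 𝔥) (isSymmetricGraph_fieldOp h)
  have hg := hs.graph_toLinearPMap (total_algGraph_fieldOp h)
  have hcl := IsSymmetricGraph.graph_closure (A := (algGraph 𝔥 (fieldOp h)).toLinearPMap)
    (by rw [hg]; exact hs) (by rw [hg]; exact total_algGraph_fieldOp h)
  rw [hg] at hcl
  exact hcl

theorem hasSelfAdjointCore_idTensor_fieldOp (h : E) :
    HasSelfAdjointCore (idTensor 𝔥 (fieldOp h))
      (fun p : 𝔥 × E => htmul p.1 (expVec p.2)) (fun p => htmul p.1 (fieldVec h p.2)) where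
  mem_graph p := by
    rw [graph_idTensor_fieldOp]
    exact Submodule.le_topologicalClosure _ (mem_algGraph_fieldOp h p.1 p.2)
  symm := by
    rw [graph_idTensor_fieldOp]
    exact (isSymmetricGraph_algGraph (isSymmetricGraph_fieldOp h)).topologicalClosure
  isClosed := by
    rw [graph_idTensor_fieldOp]
    exact Submodule.isClosed_topologicalClosure _
  total ψ hψ := eq_zero_of_inner_htmul_expVec fun u g => hψ (u, g)
  deficiency z ψ hz hψ := eq_zero_of_inner_fieldVec h hz fun u g => hψ (u, g)

theorem exists_weylOp (h : E) (l : ℝ) : ∃ W : HTensor 𝔥 (Fock E) →L[ℂ] HTensor 𝔥 (Fock E),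
    (∀ u g, W (htmul u (expVec g)) = htmul u (weylVec h l g)) ∧
    ∀ u g x, ⟪htmul u (expVec g), W x⟫_ℂ = ⟪htmul u (weylVec h (-l) g), x⟫_ℂ := by
  obtain ⟨W, hW⟩ := exists_continuousLinearMap_of_inner_eq
    (v := fun p : 𝔥 × E => htmul p.1 (expVec p.2)) (w := fun p => htmul p.1 (weylVec h l p.2))
    (fun ψ hψ => eq_zero_of_inner_htmul_expVec fun u g => hψ (u, g))
    (fun p q => by rw [inner_htmul, inner_htmul, inner_weylVec_weylVec])
  refine ⟨W, fun u g => hW (u, g), fun u g x => ?_⟩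
  have h1 : (innerSL ℂ (htmul u (expVec g))).comp W = innerSL ℂ (htmul u (weylVec h (-l) g)) := by
    refine ContinuousLinearMap.ext_on dense_span_htmul_expVec ?_
    rintro _ ⟨⟨v, f⟩, rfl⟩
    have := hW (v, f)
    simp only at this
    simp only [ContinuousLinearMap.comp_apply, innerSL_apply_apply, this, inner_htmul,
      inner_weylVec_expVec]
  exact DFunLike.congr_fun h1 x

theorem hasDerivAt_weylVec_zero (h g : E) :
    HasDerivAt (fun l : ℝ => weylVec h l g) (Complex.I • fieldVec h g) 0 := by
  refine (hasDerivAt_weylVec h 0 g).congr_deriv ?_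
  simp [weylExponent]

/-- The core criterion is used twice. The bounded Weyl operators of `h` commute weakly with the
field of `k`, hence with `S`; differentiating this at `l = 0` shows that `S` commutes weakly with
the field of `h`, hence with `R`. -/
theorem commute_isResolvent_fieldOp {h k : E} (hhk : ⟪h, k⟫_ℂ = ⟪k, h⟫_ℂ) {z w : ℂ}
    (hz : z.im ≠ 0) (hw : w.im ≠ 0) {R S : HTensor 𝔥 (Fock E) →L[ℂ] HTensor 𝔥 (Fock E)}
    (hR : IsResolvent (idTensor 𝔥 (fieldOp h)) z R)
    (hS : IsResolvent (idTensor 𝔥 (fieldOp k)) w S) : Commute R S := by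
  refine (hasSelfAdjointCore_idTensor_fieldOp h).commute_of_isResolvent hz hR ?_
  rintro ⟨v, g⟩ ⟨u, f⟩
  simp only
  have hkey : ∀ l : ℝ, ⟪htmul u (weylVec h (-l) f), S (htmul v (expVec g))⟫_ℂ =
      ⟪htmul u (expVec f), S (htmul v (weylVec h l g))⟫_ℂ := by
    intro l
    obtain ⟨W, hW, hW'⟩ := exists_weylOp (𝔥 := 𝔥) h l
    have hSW : Commute S W := by
      refine (hasSelfAdjointCore_idTensor_fieldOp k).commute_of_isResolvent hw hS ?_
      rintro ⟨v, g⟩ ⟨u, f⟩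
      simp only [hW, hW', inner_htmul, inner_weylVec_fieldVec hhk]
    rw [← hW', ← hW]
    exact congrArg _ (DFunLike.congr_fun hSW.eq _).symm
  have h1 : HasDerivAt (fun l : ℝ => ⟪htmul u (weylVec h (-l) f), S (htmul v (expVec g))⟫_ℂ)
      (Complex.I * ⟪htmul u (fieldVec h f), S (htmul v (expVec g))⟫_ℂ) 0 := by
    have hneg : HasDerivAt (fun l : ℝ => -l) (-1) 0 := (hasDerivAt_id (0 : ℝ)).neg
    have hw0 : HasDerivAt (fun l : ℝ => weylVec h l f) (Complex.I • fieldVec h f) (-0) := by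
      rw [neg_zero]; exact hasDerivAt_weylVec_zero h f
    have hw1 := HasDerivAt.scomp (h := fun l : ℝ => -l) 0 hw0 hneg
    rw [neg_one_smul, ← neg_smul] at hw1
    have h2 := ((htmulRight (Fock E) u).restrictScalars ℝ).hasFDerivAt.comp_hasDerivAt 0 hw1
    refine (h2.inner ℂ (hasDerivAt_const (0 : ℝ) (S (htmul v (expVec g))))).congr_deriv ?_
    simp only [Function.comp, ContinuousLinearMap.coe_restrictScalars', htmulRight_apply,
      inner_zero_right, zero_add, htmul_smul, inner_smul_left, map_neg, Complex.conj_I, neg_neg]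
  have h2 : HasDerivAt (fun l : ℝ => ⟪htmul u (expVec f), S (htmul v (weylVec h l g))⟫_ℂ)
      (Complex.I * ⟪htmul u (expVec f), S (htmul v (fieldVec h g))⟫_ℂ) 0 := by
    have h3 := ((S.comp (htmulRight (Fock E) v)).restrictScalars ℝ).hasFDerivAt.comp_hasDerivAt 0
      (hasDerivAt_weylVec_zero h g)
    refine ((hasDerivAt_const (0 : ℝ) (htmul u (expVec f))).inner ℂ h3).congr_deriv ?_
    simp only [ContinuousLinearMap.coe_restrictScalars', ContinuousLinearMap.comp_apply,
      htmulRight_apply, map_smul, inner_smul_right, inner_zero_left, add_zero]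
  simp only [hkey] at h1
  -- Both derivatives carry the factor `I`: on the left the sign from `-l` cancels the conjugation
  -- of `I`.
  exact mul_left_cancel₀ Complex.I_ne_zero (h1.unique h2)

/-- A bounded operator whose matrix elements between exponential vectors depend on `f` and `g` in
the direction `h` only through `exp ⟪f, g⟫` commutes weakly with the field operator of `h`. -/
theorem inner_fieldVec_eq_of_factorises {h : E}
    {V : HTensor 𝔥 (Fock E) →L[ℂ] HTensor 𝔥 (Fock E)}
    (hl : ∀ (u v : 𝔥) (f g : E) (l : ℝ),
      ⟪htmul u (expVec (f + (l : ℂ) • h)), V (htmul v (expVec g))⟫_ℂ =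
        Complex.exp (l * ⟪h, g⟫_ℂ) * ⟪htmul u (expVec f), V (htmul v (expVec g))⟫_ℂ)
    (hr : ∀ (u v : 𝔥) (f g : E) (l : ℝ),
      ⟪htmul u (expVec f), V (htmul v (expVec (g + (l : ℂ) • h)))⟫_ℂ =
        Complex.exp (l * ⟪f, h⟫_ℂ) * ⟪htmul u (expVec f), V (htmul v (expVec g))⟫_ℂ)
    (u v : 𝔥) (f g : E) :
    ⟪htmul u (fieldVec h f), V (htmul v (expVec g))⟫_ℂ =
      ⟪htmul u (expVec f), V (htmul v (fieldVec h g))⟫_ℂ := by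
  set m := ⟪htmul u (expVec f), V (htmul v (expVec g))⟫_ℂ
  have hof : HasDerivAt (fun l : ℝ => (l : ℂ)) 1 0 := Complex.ofRealCLM.hasDerivAt
  have hline : ∀ f : E,
      HasDerivAt (fun l : ℝ => expVec (f + (l : ℂ) • h)) (creationVec h f) 0 := by
    intro f
    have h0 := hasDerivAt_expVec_line h f ((0 : ℝ) : ℂ)
    have h1 := HasDerivAt.scomp (h := fun l : ℝ => (l : ℂ)) (0 : ℝ) h0 hof
    rw [one_smul, Complex.ofReal_zero, zero_smul, add_zero] at h1
    exact h1
  have hexp : ∀ c : ℂ, HasDerivAt (fun l : ℝ => Complex.exp (l * c) * m) (c * m) 0 := by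
    intro c
    refine ((hof.mul_const c).cexp.mul_const m).congr_deriv ?_
    simp
  have hleft : ⟪htmul u (creationVec h f), V (htmul v (expVec g))⟫_ℂ = ⟪h, g⟫_ℂ * m := by
    have h1 := ((htmulRight (Fock E) u).restrictScalars ℝ).hasFDerivAt.comp_hasDerivAt 0 (hline f)
    have h2 := h1.inner ℂ (hasDerivAt_const (0 : ℝ) (V (htmul v (expVec g))))
    simp only [Function.comp, ContinuousLinearMap.coe_restrictScalars', htmulRight_apply,
      inner_zero_right, zero_add] at h2
    exact h2.unique ((hexp ⟪h, g⟫_ℂ).congr_of_eventuallyEq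
      (Filter.Eventually.of_forall fun l => hl u v f g l))
  have hright : ⟪htmul u (expVec f), V (htmul v (creationVec h g))⟫_ℂ = ⟪f, h⟫_ℂ * m := by
    have h1 := ((V.comp (htmulRight (Fock E) v)).restrictScalars ℝ).hasFDerivAt.comp_hasDerivAt
      0 (hline g)
    have h2 := (hasDerivAt_const (0 : ℝ) (htmul u (expVec f))).inner ℂ h1
    simp only [Function.comp, ContinuousLinearMap.coe_restrictScalars',
      ContinuousLinearMap.comp_apply, htmulRight_apply, inner_zero_left, add_zero] at h2
    exact h2.unique ((hexp ⟪f, h⟫_ℂ).congr_of_eventuallyEq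
      (Filter.Eventually.of_forall fun l => hr u v f g l))
  have hadd : ∀ (w : 𝔥) (ψ φ : Fock E), htmul w (ψ + φ) = htmul w ψ + htmul w φ :=
    fun w ψ φ => (htmulRight (Fock E) w).map_add ψ φ
  rw [fieldVec, fieldVec, hadd, hadd, map_add, inner_add_left, inner_add_right, hleft, hright,
    htmul_smul, htmul_smul, map_smul, inner_smul_left, inner_smul_right, inner_conj_symm]
  ring

/-- `exp (-⟪g, d⟫) u ⊗ e(f + d)` has the same inner product as `u ⊗ e(f)` with all `w ⊗ e(g')`
such that `⟪g', d⟫ = ⟪g, d⟫`. -/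
theorem inner_htmul_expVec_shift {d f g g' : E} (u w : 𝔥) (h : ⟪g', d⟫_ℂ = ⟪g, d⟫_ℂ) :
    ⟪htmul w (expVec g'), htmul u (expVec f)⟫_ℂ =
      ⟪htmul w (expVec g'), Complex.exp (-⟪g, d⟫_ℂ) • htmul u (expVec (f + d))⟫_ℂ := by
  rw [inner_smul_right, inner_htmul, inner_htmul, inner_expVec, inner_expVec, inner_add_right, h,
    mul_left_comm, ← Complex.exp_add, neg_add_cancel_comm_assoc]

/-- The conjugate of `exp (-⟪g, d⟫)` is `exp (-⟪d, g⟫)`, the inverse of the factor in `h`. So the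
normalisation of `inner_htmul_expVec_shift` also fits vectors whose matrix elements factorise. -/
theorem inner_exp_smul_left_eq {K : Type*} [NormedAddCommGroup K] [InnerProductSpace ℂ K]
    {x x' y : K} {d f g : E}
    (h : ⟪x', y⟫_ℂ = Complex.exp (⟪f + d, g⟫_ℂ - ⟪f, g⟫_ℂ) * ⟪x, y⟫_ℂ) :
    ⟪Complex.exp (-⟪g, d⟫_ℂ) • x', y⟫_ℂ = ⟪x, y⟫_ℂ := by
  rw [inner_smul_left, h, ← mul_assoc, ← Complex.exp_conj, ← Complex.exp_add, inner_add_left,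
    map_neg, inner_conj_symm, add_sub_cancel_left, neg_add_cancel, Complex.exp_zero, one_mul]

end Quadratures

/-! ### Linear differential equations with integrable coefficients -/

section LinearODE

/-- Grönwall with a merely integrable coefficient, by continuation: the zero set of `y` is closed,
contains `a`, and extends to the right of any point up to which `y` vanishes. -/
theorem eq_zero_of_le_integral_mul {a b : ℝ} {κ y : ℝ → ℝ} (hκ : IntervalIntegrable κ volume a b)
    (hκ0 : ∀ r, 0 ≤ κ r) (hy : ContinuousOn y (Set.Icc a b)) (hy0 : ∀ r, 0 ≤ y r)
    (h : ∀ t ∈ Set.Icc a b, y t ≤ ∫ r in a..t, κ r * y r) : ∀ t ∈ Set.Icc a b, y t = 0 := by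
  intro t ht
  have hab : a ≤ b := ht.1.trans ht.2
  suffices Set.Icc a b ⊆ {t | y t = 0} from this ht
  refine IsClosed.Icc_subset_of_forall_mem_nhdsGT_of_Icc_subset ?_ ?_ ?_
  · have : {t | y t = 0} ∩ Set.Icc a b = Set.Icc a b ∩ y ⁻¹' {0} := by
      ext t; simp [and_comm]
    rw [this]
    exact hy.preimage_isClosed_of_isClosed isClosed_Icc isClosed_singleton
  · have := h a (Set.left_mem_Icc.mpr hab)
    rw [intervalIntegral.integral_same] at this
    exact le_antisymm this (hy0 a)
  · intro x hx hzero
    have hxb : Set.uIcc x b ⊆ Set.uIcc a b := by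
      rw [Set.uIcc_of_le hx.2.le, Set.uIcc_of_le hab]; exact Set.Icc_subset_Icc_left hx.1
    have hκx : IntervalIntegrable κ volume x b := hκ.mono_set hxb
    have hcont : ContinuousOn (fun t => ∫ r in x..t, κ r) (Set.Icc x b) := by
      have := intervalIntegral.continuousOn_primitive_interval' hκx Set.left_mem_uIcc
      rwa [Set.uIcc_of_le hx.2.le] at this
    -- Any bound below `1` would do: the maximum of `y` on `[x, c]` is then at most half of itself.
    obtain ⟨c, hc, hcκ⟩ : ∃ c ∈ Set.Ioc x b, ∫ r in x..c, κ r ≤ 1 / 2 := by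
      have h1 : ContinuousWithinAt (fun t => ∫ r in x..t, κ r) (Set.Ioc x b) x :=
        (hcont x (Set.left_mem_Icc.mpr hx.2.le)).mono Set.Ioc_subset_Icc_self
      have h2 : ∀ᶠ c in nhdsWithin x (Set.Ioc x b), ∫ r in x..c, κ r < 1 / 2 := by
        refine h1.eventually_lt_const ?_
        simp
      have h3 : (nhdsWithin x (Set.Ioc x b)).NeBot := by
        rw [← mem_closure_iff_nhdsWithin_neBot, closure_Ioc hx.2.ne]
        exact Set.left_mem_Icc.mpr hx.2.le
      obtain ⟨c, hc1, hc2⟩ := (h2.and self_mem_nhdsWithin).exists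
      exact ⟨c, hc2, hc1.le⟩
    have hsub : Set.Icc x c ⊆ Set.Icc a b := Set.Icc_subset_Icc hx.1 hc.2
    obtain ⟨t₀, ht₀, hmax⟩ := isCompact_Icc.exists_isMaxOn (Set.nonempty_Icc.mpr hc.1.le)
      (hy.mono hsub)
    have hint : ∀ {p q : ℝ}, a ≤ p → p ≤ q → q ≤ b →
        IntervalIntegrable (fun r => κ r * y r) volume p q := by
      intro p q hp hpq hq
      have hsub' : Set.uIcc p q ⊆ Set.uIcc a b := by
        rw [Set.uIcc_of_le hpq, Set.uIcc_of_le hab]; exact Set.Icc_subset_Icc hp hq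
      refine (hκ.mono_set hsub').mul_continuousOn (hy.mono ?_)
      rwa [Set.uIcc_of_le hab] at hsub'
    have hM : y t₀ ≤ y t₀ * (1 / 2) := by
      have h1 := h t₀ (hsub ht₀)
      have h2 : ∫ r in a..x, κ r * y r = 0 := by
        rw [intervalIntegral.integral_congr (g := fun _ => (0 : ℝ)), intervalIntegral.integral_zero]
        intro r hr
        rw [Set.uIcc_of_le hx.1] at hr
        have : y r = 0 := hzero hr
        simp [this]
      rw [← intervalIntegral.integral_add_adjacent_intervals (hint le_rfl hx.1 hx.2.le)
        (hint hx.1 ht₀.1 (ht₀.2.trans hc.2)), h2, zero_add] at h1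
      have hκ1 : IntervalIntegrable κ volume x t₀ := by
        refine hκx.mono_set ?_
        rw [Set.uIcc_of_le hx.2.le, Set.uIcc_of_le ht₀.1]
        exact Set.Icc_subset_Icc_right (ht₀.2.trans hc.2)
      have hκ2 : IntervalIntegrable κ volume t₀ c := by
        refine hκx.mono_set ?_
        rw [Set.uIcc_of_le hx.2.le, Set.uIcc_of_le ht₀.2]
        exact Set.Icc_subset_Icc ht₀.1 hc.2
      have h3 : ∫ r in x..t₀, κ r * y r ≤ ∫ r in x..t₀, κ r * y t₀ := by
        refine intervalIntegral.integral_mono_on ht₀.1 (hint hx.1 ht₀.1 (ht₀.2.trans hc.2))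
          (hκ1.mul_const _) fun r hr => ?_
        exact mul_le_mul_of_nonneg_left (hmax ⟨hr.1, hr.2.trans ht₀.2⟩) (hκ0 r)
      have h4 : ∫ r in x..t₀, κ r ≤ ∫ r in x..c, κ r := by
        rw [← intervalIntegral.integral_add_adjacent_intervals hκ1 hκ2]
        have := intervalIntegral.integral_nonneg (μ := volume) ht₀.2 fun r _ => hκ0 r
        linarith
      rw [intervalIntegral.integral_mul_const] at h3
      have h5 : (∫ r in x..t₀, κ r) * y t₀ ≤ 1 / 2 * y t₀ :=
        mul_le_mul_of_nonneg_right (h4.trans hcκ) (hy0 _)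
      linarith
    have hM0 : y t₀ ≤ 0 := by linarith
    refine Filter.mem_of_superset (Ioc_mem_nhdsGT hc.1) fun r hr => ?_
    exact le_antisymm ((hmax ⟨hr.1.le, hr.2⟩).trans hM0) (hy0 r)

theorem intervalIntegrable_sum {ι G : Type*} [Fintype ι] [NormedAddCommGroup G] {F : ι → ℝ → G}
    {s t : ℝ} (h : ∀ k, IntervalIntegrable (F k) volume s t) :
    IntervalIntegrable (fun r => ∑ k, F k r) volume s t := by
  have := IntervalIntegrable.sum Finset.univ fun k _ => h k
  rwa [Finset.sum_fn] at this

variable {n : ℕ} {𝔥 : Type*} [NormedAddCommGroup 𝔥] [InnerProductSpace ℂ 𝔥] [CompleteSpace 𝔥]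

/-- The generator of the matrix elements of the evolution between `e(f)` and `e(g)`. -/
def matrixGenerator (L : Fin n → 𝔥 →L[ℂ] 𝔥) (H : 𝔥 →L[ℂ] 𝔥) (x y : EuclideanSpace ℂ (Fin n)) :
    𝔥 →L[ℂ] 𝔥 :=
  ∑ k, (conj (x k) • L k - y k • star (L k)) + driftCoeff L H

/-- `φ` is a weak solution on `[s, t]` of `φ' = matrixGenerator (f r) (g r) φ`, `φ(s) = φ₀`. -/
structure IsWeakSolution (L : Fin n → 𝔥 →L[ℂ] 𝔥) (H : 𝔥 →L[ℂ] 𝔥)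
    (f g : ℝ → EuclideanSpace ℂ (Fin n)) (s t : ℝ) (φ : ℝ → 𝔥) (φ₀ : 𝔥) : Prop where
  continuousOn : ContinuousOn φ (Set.Icc s t)
  integral_eq : ∀ τ ∈ Set.Icc s t, ∀ u : 𝔥, ⟪u, φ τ⟫_ℂ =
    ⟪u, φ₀⟫_ℂ + ∫ r in s..τ, ⟪u, matrixGenerator L H (f r) (g r) (φ r)⟫_ℂ

variable {L : Fin n → 𝔥 →L[ℂ] 𝔥} {H : 𝔥 →L[ℂ] 𝔥} {f g f' g' : ℝ → EuclideanSpace ℂ (Fin n)}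
  {s t : ℝ} {φ χ : ℝ → 𝔥} {φ₀ : 𝔥}

/-- A bound for the norm of `matrixGenerator`. -/
def matrixGeneratorBound (L : Fin n → 𝔥 →L[ℂ] 𝔥) (H : 𝔥 →L[ℂ] 𝔥)
    (x y : EuclideanSpace ℂ (Fin n)) : ℝ :=
  ∑ k, (‖x k‖ * ‖L k‖ + ‖y k‖ * ‖L k‖) + ‖driftCoeff L H‖

theorem norm_matrixGenerator_le (x y : EuclideanSpace ℂ (Fin n)) :
    ‖matrixGenerator L H x y‖ ≤ matrixGeneratorBound L H x y := by
  refine (norm_add_le _ _).trans (add_le_add ((norm_sum_le _ _).trans ?_) le_rfl)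
  refine Finset.sum_le_sum fun k _ => (norm_sub_le _ _).trans (le_of_eq ?_)
  rw [norm_smul, norm_smul, norm_star, RCLike.norm_conj]

theorem matrixGeneratorBound_nonneg (x y : EuclideanSpace ℂ (Fin n)) :
    0 ≤ matrixGeneratorBound L H x y :=
  (norm_nonneg _).trans (norm_matrixGenerator_le x y)

theorem intervalIntegrable_matrixGeneratorBound
    (hf : ∀ k, IntervalIntegrable (fun r => f r k) volume s t)
    (hg : ∀ k, IntervalIntegrable (fun r => g r k) volume s t) :
    IntervalIntegrable (fun r => matrixGeneratorBound L H (f r) (g r)) volume s t := by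
  refine IntervalIntegrable.add ?_ intervalIntegrable_const
  exact intervalIntegrable_sum fun k =>
    ((hf k).norm.mul_const _).add ((hg k).norm.mul_const _)

/-- Expanding the generator leaves integrable scalar coefficients times continuous functions. -/
theorem intervalIntegrable_inner_matrixGenerator (hst : s ≤ t)
    (hf : ∀ k, IntervalIntegrable (fun r => f r k) volume s t)
    (hg : ∀ k, IntervalIntegrable (fun r => g r k) volume s t)
    (hφ : ContinuousOn φ (Set.Icc s t)) (u : 𝔥) :
    IntervalIntegrable (fun r => ⟪u, matrixGenerator L H (f r) (g r) (φ r)⟫_ℂ) volume s t := by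
  have hX : ∀ X : 𝔥 →L[ℂ] 𝔥, ContinuousOn (fun r => ⟪u, X (φ r)⟫_ℂ) (Set.uIcc s t) := by
    intro X
    rw [Set.uIcc_of_le hst]
    exact continuousOn_const.inner (X.continuous.comp_continuousOn hφ)
  have h1 : (fun r => ⟪u, matrixGenerator L H (f r) (g r) (φ r)⟫_ℂ) = fun r =>
      (∑ k, (conj (f r k) * ⟪u, L k (φ r)⟫_ℂ - g r k * ⟪u, star (L k) (φ r)⟫_ℂ))
        + ⟪u, driftCoeff L H (φ r)⟫_ℂ := by
    funext r
    simp only [matrixGenerator, add_apply, sum_apply,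
      sub_apply, smul_apply, inner_add_right, inner_sum,
      inner_sub_right, inner_smul_right]
  rw [h1]
  refine IntervalIntegrable.add ?_ (hX _).intervalIntegrable
  refine intervalIntegrable_sum fun k => IntervalIntegrable.sub ?_ ?_
  · refine IntervalIntegrable.mul_continuousOn ?_ (hX _)
    have := hf k
    rw [intervalIntegrable_iff] at this ⊢
    exact (Complex.conjLIE.toContinuousLinearEquiv.toContinuousLinearMap.integrable_comp this)
  · exact (hg k).mul_continuousOn (hX _)

namespace IsWeakSolution

theorem congr_ae (h : IsWeakSolution L H f g s t φ φ₀)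
    (hf : ∀ᵐ r ∂volume.restrict (Set.Ioc s t), f r = f' r)
    (hg : ∀ᵐ r ∂volume.restrict (Set.Ioc s t), g r = g' r) :
    IsWeakSolution L H f' g' s t φ φ₀ := by
  refine ⟨h.continuousOn, fun τ hτ u => ?_⟩
  rw [h.integral_eq τ hτ u]
  congr 1
  rw [intervalIntegral.integral_of_le hτ.1, intervalIntegral.integral_of_le hτ.1]
  refine integral_congr_ae ?_
  have hle : volume.restrict (Set.Ioc s τ) ≤ volume.restrict (Set.Ioc s t) :=
    Measure.restrict_mono_set _ (Set.Ioc_subset_Ioc_right hτ.2)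
  filter_upwards [ae_mono hle hf, ae_mono hle hg] with r h1 h2
  rw [h1, h2]

theorem const_smul (h : IsWeakSolution L H f g s t φ φ₀) (c : ℂ) :
    IsWeakSolution L H f g s t (fun r => c • φ r) (c • φ₀) := by
  refine ⟨h.continuousOn.const_smul c, fun τ hτ u => ?_⟩
  simp only [inner_smul_right, map_smul, intervalIntegral.integral_const_mul]
  rw [h.integral_eq τ hτ u, mul_add]

theorem unique (hst : s ≤ t) (hf : ∀ k, IntervalIntegrable (fun r => f r k) volume s t)
    (hg : ∀ k, IntervalIntegrable (fun r => g r k) volume s t)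
    (h : IsWeakSolution L H f g s t φ φ₀) (h' : IsWeakSolution L H f g s t χ φ₀) :
    ∀ τ ∈ Set.Icc s t, φ τ = χ τ := by
  have hsub : ∀ τ ∈ Set.Icc s t, Set.uIcc s τ ⊆ Set.uIcc s t := by
    intro τ hτ
    rw [Set.uIcc_of_le hτ.1, Set.uIcc_of_le hst]
    exact Set.Icc_subset_Icc_right hτ.2
  have hd : ∀ τ ∈ Set.Icc s t, ∀ u : 𝔥, ⟪u, φ τ - χ τ⟫_ℂ =
      ∫ r in s..τ, ⟪u, matrixGenerator L H (f r) (g r) (φ r - χ r)⟫_ℂ := by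
    intro τ hτ u
    have hI : ∀ {φ : ℝ → 𝔥}, ContinuousOn φ (Set.Icc s t) → IntervalIntegrable
        (fun r => ⟪u, matrixGenerator L H (f r) (g r) (φ r)⟫_ℂ) volume s τ := fun hφ =>
      (intervalIntegrable_inner_matrixGenerator hst hf hg hφ u).mono_set (hsub τ hτ)
    simp only [map_sub, inner_sub_right]
    rw [intervalIntegral.integral_sub (hI h.continuousOn) (hI h'.continuousOn),
      h.integral_eq τ hτ u, h'.integral_eq τ hτ u]
    ring
  have hc : ContinuousOn (fun r => ‖φ r - χ r‖) (Set.Icc s t) :=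
    (h.continuousOn.sub h'.continuousOn).norm
  have hκ := intervalIntegrable_matrixGeneratorBound (L := L) (H := H) hf hg
  have hzero := eq_zero_of_le_integral_mul hκ (fun r => matrixGeneratorBound_nonneg _ _) hc
    (fun r => norm_nonneg _) (fun τ hτ => ?_)
  · exact fun τ hτ => sub_eq_zero.mp (norm_eq_zero.mp (hzero τ hτ))
  · have hbi : IntervalIntegrable (fun r => matrixGeneratorBound L H (f r) (g r) * ‖φ r - χ r‖)
        volume s τ := by
      refine (hκ.mul_continuousOn ?_).mono_set (hsub τ hτ)
      rwa [Set.uIcc_of_le hst]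
    -- Testing the weak equation at time `τ` against `φ τ - χ τ` itself recovers a norm estimate;
    -- one factor is cancelled below.
    have h1 : ‖φ τ - χ τ‖ * ‖φ τ - χ τ‖ ≤ ‖φ τ - χ τ‖ *
        ∫ r in s..τ, matrixGeneratorBound L H (f r) (g r) * ‖φ r - χ r‖ := by
      have h2 : ‖φ τ - χ τ‖ * ‖φ τ - χ τ‖ = ‖⟪φ τ - χ τ, φ τ - χ τ⟫_ℂ‖ := by
        rw [inner_self_eq_norm_sq_to_K, norm_pow, RCLike.norm_ofReal, abs_norm, sq]
      rw [h2, hd τ hτ, ← intervalIntegral.integral_const_mul]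
      refine intervalIntegral.norm_integral_le_of_norm_le hτ.1 ?_ (hbi.const_mul _)
      refine Filter.Eventually.of_forall fun r _ => (norm_inner_le_norm _ _).trans ?_
      refine mul_le_mul_of_nonneg_left ?_ (norm_nonneg _)
      exact ((matrixGenerator L H (f r) (g r)).le_opNorm _).trans
        (mul_le_mul_of_nonneg_right (norm_matrixGenerator_le _ _) (norm_nonneg _))
    rcases (norm_nonneg (φ τ - χ τ)).eq_or_lt with h0 | hpos
    · rw [← h0]
      exact intervalIntegral.integral_nonneg hτ.1 fun r _ =>
        mul_nonneg (matrixGeneratorBound_nonneg _ _) (norm_nonneg _)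
    · exact le_of_mul_le_mul_left h1 hpos

theorem restrict {m : ℝ} (hsm : s ≤ m) (hmt : m ≤ t)
    (hf : ∀ k, IntervalIntegrable (fun r => f r k) volume s t)
    (hg : ∀ k, IntervalIntegrable (fun r => g r k) volume s t)
    (h : IsWeakSolution L H f g s t φ φ₀) : IsWeakSolution L H f g m t φ (φ m) := by
  have hst := hsm.trans hmt
  refine ⟨h.continuousOn.mono (Set.Icc_subset_Icc_left hsm), fun τ hτ u => ?_⟩
  have hI := intervalIntegrable_inner_matrixGenerator (L := L) (H := H) hst hf hg h.continuousOn u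
  have h1 : Set.uIcc s m ⊆ Set.uIcc s t := by
    rw [Set.uIcc_of_le hsm, Set.uIcc_of_le hst]; exact Set.Icc_subset_Icc_right hmt
  have h2 : Set.uIcc m τ ⊆ Set.uIcc s t := by
    rw [Set.uIcc_of_le hτ.1, Set.uIcc_of_le hst]; exact Set.Icc_subset_Icc hsm hτ.2
  rw [h.integral_eq τ ⟨hsm.trans hτ.1, hτ.2⟩, h.integral_eq m ⟨hsm, hmt⟩,
    ← intervalIntegral.integral_add_adjacent_intervals (hI.mono_set h1) (hI.mono_set h2), add_assoc]

/-- The weak equation passes from a set of initial vectors to their closed span. -/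
theorem of_mem_topologicalClosure_span {K : Type*} [NormedAddCommGroup K] [InnerProductSpace ℂ K]
    {V : ℝ → K →L[ℂ] K} {B : K →L[ℂ] 𝔥} {X : Set K}
    (hf : ∀ k, IntervalIntegrable (fun r => f r k) volume s t)
    (hg : ∀ k, IntervalIntegrable (fun r => g r k) volume s t)
    (hV : ∀ r x, ‖V r x‖ = ‖x‖) (hc : ∀ x, ContinuousOn (fun r => V r x) (Set.Icc s t))
    (hX : ∀ x ∈ X, IsWeakSolution L H f g s t (fun r => B (V r x)) (B x)) {ξ : K}
    (hξ : ξ ∈ (Submodule.span ℂ X).topologicalClosure) :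
    IsWeakSolution L H f g s t (fun r => B (V r ξ)) (B ξ) := by
  have hcB : ∀ x, ContinuousOn (fun r => B (V r x)) (Set.Icc s t) := fun x =>
    B.continuous.comp_continuousOn (hc x)
  refine ⟨hcB ξ, fun τ hτ u => ?_⟩
  have hsub : Set.uIcc s τ ⊆ Set.uIcc s t := by
    rw [Set.uIcc_of_le hτ.1, Set.uIcc_of_le (hτ.1.trans hτ.2)]
    exact Set.Icc_subset_Icc_right hτ.2
  have hI : ∀ x, IntervalIntegrable (fun r => ⟪u, matrixGenerator L H (f r) (g r)
      (B (V r x))⟫_ℂ) volume s τ := fun x =>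
    (intervalIntegrable_inner_matrixGenerator (hτ.1.trans hτ.2) hf hg (hcB x) u).mono_set hsub
  have hB := (intervalIntegrable_matrixGeneratorBound (L := L) (H := H) hf hg).mono_set hsub
  let Λ : K →L[ℂ] ℂ := LinearMap.mkContinuous
    { toFun := fun x => ∫ r in s..τ, ⟪u, matrixGenerator L H (f r) (g r) (B (V r x))⟫_ℂ
      map_add' := fun x y => by
        simp only [map_add, inner_add_right]
        exact intervalIntegral.integral_add (hI x) (hI y)
      map_smul' := fun c x => by
        simp only [map_smul, inner_smul_right, RingHom.id_apply, smul_eq_mul,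
          intervalIntegral.integral_const_mul] }
    (‖u‖ * ‖B‖ * ∫ r in s..τ, matrixGeneratorBound L H (f r) (g r))
    (fun x => by
      have h1 : ‖∫ r in s..τ, ⟪u, matrixGenerator L H (f r) (g r) (B (V r x))⟫_ℂ‖ ≤
          ∫ r in s..τ, ‖u‖ * ‖B‖ * ‖x‖ * matrixGeneratorBound L H (f r) (g r) := by
        refine intervalIntegral.norm_integral_le_of_norm_le hτ.1 ?_ (hB.const_mul _)
        refine Filter.Eventually.of_forall fun r _ => (norm_inner_le_norm _ _).trans ?_
        have h2 : ‖B (V r x)‖ ≤ ‖B‖ * ‖x‖ :=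
          (B.le_opNorm _).trans (le_of_eq (by rw [hV]))
        have h3 := (matrixGenerator L H (f r) (g r)).le_of_opNorm_le_of_le
          (norm_matrixGenerator_le _ _) h2
        calc _ ≤ ‖u‖ * (matrixGeneratorBound L H (f r) (g r) * (‖B‖ * ‖x‖)) := by gcongr
          _ = _ := by ring
      rw [intervalIntegral.integral_const_mul] at h1
      exact h1.trans (le_of_eq (by ring)))
  -- At fixed `τ` and `u`, both sides of the weak equation are bounded functionals of the initial
  -- vector; isometry of `V r` makes the bound for `Λ` uniform in time.
  have heq := ContinuousLinearMap.eqOn_closure_span (s := X)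
    (f := (innerSL ℂ u).comp (B.comp (V τ))) (g := (innerSL ℂ u).comp B + Λ)
    fun x hx => (hX x hx).integral_eq τ hτ u
  exact heq hξ

end IsWeakSolution

end LinearODE

/-! ### The evolution of the coupled system -/

theorem hasSelfAdjointCore_idTensor_inputQuadrature {n : ℕ} {𝔥 : Type*} [NormedAddCommGroup 𝔥]
    [InnerProductSpace ℂ 𝔥] (k : Fin n) (t : ℝ) :
    HasSelfAdjointCore (idTensor 𝔥 (inputQuadrature k t))
      (fun p : 𝔥 × OneParticle n => htmul p.1 (expVec p.2))
      (fun p => htmul p.1 (fieldVec (channelIndicator k t) p.2)) :=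
  hasSelfAdjointCore_idTensor_fieldOp (channelIndicator k t)

/-- Resolvents at `i` and `-i` suffice, and they are transported from the input quadrature by
conjugation. -/
theorem isSelfAdjoint_outputQuadrature {n : ℕ} {𝔥 : Type*} [NormedAddCommGroup 𝔥]
    [InnerProductSpace ℂ 𝔥]
    (U : ℝ → ℝ → unitary (HTensor 𝔥 (Bath n) →L[ℂ] HTensor 𝔥 (Bath n))) (k : Fin n) (t : ℝ) :
    IsSelfAdjoint (outputQuadrature U k t) := by
  have hcore := hasSelfAdjointCore_idTensor_inputQuadrature (𝔥 := 𝔥) k t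
  obtain ⟨R, hR⟩ := hcore.exists_isResolvent (z := Complex.I) (by simp)
  obtain ⟨S, hS⟩ := hcore.exists_isResolvent (z := conj Complex.I) (by simp)
  exact isSelfAdjoint_of_isResolvent (hcore.symm.unitaryConj (U t 0))
    (dense_domain_unitaryConj hcore.dense_domain (U t 0)) (hR.unitaryConj (U t 0))
    (hS.unitaryConj (U t 0))

section Evolution

variable {n : ℕ} {𝔥 : Type*} [NormedAddCommGroup 𝔥] [InnerProductSpace ℂ 𝔥] [CompleteSpace 𝔥]

/-- The partial inner product with `ψ`: `⟪u, slice ψ x⟫ = ⟪u ⊗ ψ, x⟫`. -/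
def slice {F : Type*} [NormedAddCommGroup F] [InnerProductSpace ℂ F] (ψ : F) :
    HTensor 𝔥 F →L[ℂ] 𝔥 :=
  (htmulLeft 𝔥 ψ).adjoint

theorem inner_slice {F : Type*} [NormedAddCommGroup F] [InnerProductSpace ℂ F] (u : 𝔥) (ψ : F)
    (x : HTensor 𝔥 F) : ⟪u, slice ψ x⟫_ℂ = ⟪htmul u ψ, x⟫_ℂ := by
  rw [slice, ContinuousLinearMap.adjoint_inner_right, htmulLeft_apply]

theorem slice_htmul {F : Type*} [NormedAddCommGroup F] [InnerProductSpace ℂ F] (v : 𝔥) (ψ φ : F) :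
    slice ψ (htmul v φ) = ⟪ψ, φ⟫_ℂ • v := by
  refine ext_inner_left ℂ fun u => ?_
  rw [inner_slice, inner_htmul, inner_smul_right, mul_comm]

theorem inner_htmul_generator {F : Type*} [NormedAddCommGroup F] [InnerProductSpace ℂ F]
    (L : Fin n → 𝔥 →L[ℂ] 𝔥) (H : 𝔥 →L[ℂ] 𝔥) (a b : EuclideanSpace ℂ (Fin n)) (u : 𝔥) (ψ : F)
    (x : HTensor 𝔥 F) :
    ⟪htmul u ψ, (∑ k, (conj (a k) • tensorId F (L k) - b k • tensorId F (star (L k))) +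
      tensorId F (driftCoeff L H)) x⟫_ℂ = ⟪u, matrixGenerator L H a b (slice ψ x)⟫_ℂ := by
  have hX : ∀ X : 𝔥 →L[ℂ] 𝔥, ⟪htmul u ψ, tensorId F X x⟫_ℂ = ⟪u, X (slice ψ x)⟫_ℂ := fun X => by
    rw [inner_htmul_tensorId, ← inner_slice, ContinuousLinearMap.adjoint_inner_left]
  simp only [matrixGenerator, add_apply, sum_apply, sub_apply, smul_apply, inner_add_right,
    inner_sum, inner_sub_right, inner_smul_right, hX]

/-- Square integrable functions are integrable on bounded intervals; this is the only regularity of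
the coefficients in the matrix-element equations. -/
theorem OneParticle.intervalIntegrable (f : OneParticle n) {s t : ℝ} (hs : 0 ≤ s) (hst : s ≤ t)
    (k : Fin n) : IntervalIntegrable (fun r => f r k) volume s t := by
  rw [intervalIntegrable_iff_integrableOn_Ioc_of_le hst]
  have hle : volume.restrict (Set.Ioc s t) ≤ volume.restrict (Set.Ici (0 : ℝ)) :=
    Measure.restrict_mono_set _ fun r hr => hs.trans hr.1.le
  have h1 : MemLp f 2 (volume.restrict (Set.Ioc s t)) := (Lp.memLp f).mono_measure hle
  have h2 : Integrable f (volume.restrict (Set.Ioc s t)) := h1.integrable (by norm_num)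
  exact (EuclideanSpace.proj (𝕜 := ℂ) k).integrable_comp h2

theorem OneParticle.inner_congr {f g d : OneParticle n}
    (h : ∀ᵐ r ∂volume.restrict (Set.Ici (0 : ℝ)), d r = 0 ∨ f r = g r) :
    ⟪f, d⟫_ℂ = ⟪g, d⟫_ℂ := by
  rw [L2.inner_def, L2.inner_def]
  refine integral_congr_ae ?_
  filter_upwards [h] with r hr
  rcases hr with hr | hr
  · rw [hr, inner_zero_right, inner_zero_right]
  · rw [hr]

/-- The part of `f` after time `s`. -/
def OneParticle.after (s : ℝ) (f : OneParticle n) : OneParticle n :=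
  ((Lp.memLp f).indicator (measurableSet_Ioi (a := s))).toLp _

theorem OneParticle.after_ae (s : ℝ) (f : OneParticle n) :
    ∀ᵐ r ∂volume.restrict (Set.Ici (0 : ℝ)), f.after s r = (Set.Ioi s).indicator f r :=
  MemLp.coeFn_toLp _

theorem ae_restrict_Ioc_of_ae_restrict_Ici {p : ℝ → Prop} {s t : ℝ} (hs : 0 ≤ s)
    (h : ∀ᵐ r ∂volume.restrict (Set.Ici (0 : ℝ)), p r) :
    ∀ᵐ r ∂volume.restrict (Set.Ioc s t), s < r ∧ r ≤ t ∧ p r := by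
  have hle : volume.restrict (Set.Ioc s t) ≤ volume.restrict (Set.Ici (0 : ℝ)) :=
    Measure.restrict_mono_set _ fun r hr => hs.trans hr.1.le
  filter_upwards [ae_mono hle h, ae_restrict_mem measurableSet_Ioc] with r h1 h2
  exact ⟨h2.1, h2.2, h1⟩

theorem add_smul_channelIndicator_ae (f : OneParticle n) (c : ℂ) (k : Fin n) {s t : ℝ}
    (hs : 0 ≤ s) : ∀ᵐ r ∂volume.restrict (Set.Ioc s t),
      (f + c • channelIndicator k s : OneParticle n) r = f r := by
  have h : ∀ᵐ r ∂volume.restrict (Set.Ici (0 : ℝ)), s < r →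
      (f + c • channelIndicator k s : OneParticle n) r = f r := by
    filter_upwards [Lp.coeFn_add f (c • channelIndicator k s),
      Lp.coeFn_smul c (channelIndicator k s), indicatorConstLp_coeFn (p := 2)
        (μ := volume.restrict (Set.Ici (0 : ℝ))) (s := Set.Icc 0 s) (hs := measurableSet_Icc)
        (hμs := ((Measure.restrict_apply_le _ _).trans_lt measure_Icc_lt_top).ne)
        (c := EuclideanSpace.single k (1 : ℂ))] with r h1 h2 h3 hr
    have h4 : channelIndicator k s r = 0 := by
      refine h3.trans (Set.indicator_of_notMem (fun hmem => ?_) _)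
      exact absurd hmem.2 (not_le.mpr hr)
    rw [h1, Pi.add_apply, h2, Pi.smul_apply, h4, smul_zero, add_zero]
  filter_upwards [ae_restrict_Ioc_of_ae_restrict_Ici (t := t) hs h] with r hr
  exact hr.2.2 hr.1

/-- The indicator functions have real values, so their inner products are real: the reason that the
input quadratures commute at all times and in all channels. -/
theorem inner_channelIndicator_comm (j k : Fin n) (s t : ℝ) :
    ⟪channelIndicator j t, channelIndicator k s⟫_ℂ =
      ⟪channelIndicator k s, channelIndicator j t⟫_ℂ := by
  have hfin : ∀ r : ℝ, volume.restrict (Set.Ici (0 : ℝ)) (Set.Icc 0 r) ≠ ⊤ := fun r =>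
    ((Measure.restrict_apply_le _ _).trans_lt measure_Icc_lt_top).ne
  rw [channelIndicator, channelIndicator,
    L2.inner_indicatorConstLp_indicatorConstLp _ _ (hfin t) (hfin s),
    L2.inner_indicatorConstLp_indicatorConstLp _ _ (hfin s) (hfin t), Set.inter_comm]
  congr 1
  rw [EuclideanSpace.inner_single_left, EuclideanSpace.inner_single_left]
  simp only [PiLp.single_apply, map_one, one_mul, eq_comm]

namespace IsTimeOrderedExponential

variable {L : Fin n → 𝔥 →L[ℂ] 𝔥} {H : 𝔥 →L[ℂ] 𝔥}
  {U : ℝ → ℝ → unitary (HTensor 𝔥 (Bath n) →L[ℂ] HTensor 𝔥 (Bath n))}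

theorem continuousOn_slice (hU : IsTimeOrderedExponential L H U) {s : ℝ} (hs : 0 ≤ s) (t : ℝ)
    (ψ : Bath n) (x : HTensor 𝔥 (Bath n)) :
    ContinuousOn (fun r => slice ψ ((U r s).1 x)) (Set.Icc s t) :=
  (slice ψ).continuous.comp_continuousOn
    ((hU.continuousOn s hs x).mono Set.Icc_subset_Ici_self)

theorem isWeakSolution_slice (hU : IsTimeOrderedExponential L H U) {s : ℝ} (hs : 0 ≤ s) (t : ℝ)
    (v : 𝔥) (f g : OneParticle n) :
    IsWeakSolution L H f g s t (fun r => slice (expVec f) ((U r s).1 (htmul v (expVec g))))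
      (slice (expVec f) (htmul v (expVec g))) := by
  refine ⟨hU.continuousOn_slice hs t _ _, fun τ hτ u => ?_⟩
  rw [inner_slice, inner_slice, hU.integral_eq s τ hs hτ.1]
  simp only [inner_htmul_generator]

/-- The matrix elements of `U(t, s)` factorise: they depend on `f` and `g` outside `[s, t]` only
through `exp ⟪f, g⟫`. -/
theorem inner_eq_exp_mul (hU : IsTimeOrderedExponential L H U) {s t : ℝ} (hs : 0 ≤ s)
    (hst : s ≤ t) (u v : 𝔥) {f g f' g' : OneParticle n}
    (hf : ∀ᵐ r ∂volume.restrict (Set.Ioc s t), f' r = f r)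
    (hg : ∀ᵐ r ∂volume.restrict (Set.Ioc s t), g' r = g r) :
    ⟪htmul u (expVec f'), (U t s).1 (htmul v (expVec g'))⟫_ℂ =
      Complex.exp (⟪f', g'⟫_ℂ - ⟪f, g⟫_ℂ) *
        ⟪htmul u (expVec f), (U t s).1 (htmul v (expVec g))⟫_ℂ := by
  set c := Complex.exp (⟪f', g'⟫_ℂ - ⟪f, g⟫_ℂ)
  have h1 := (hU.isWeakSolution_slice hs t v f' g').congr_ae hf hg
  have h2 := (hU.isWeakSolution_slice hs t v f g).const_smul c
  -- The two curves solve the same equation on `[s, t]`; the factor `c` is exactly the ratio of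
  -- their initial values.
  have h3 : c • slice (expVec f) (htmul v (expVec g)) = slice (expVec f') (htmul v (expVec g')) := by
    rw [slice_htmul, slice_htmul, inner_expVec, inner_expVec, smul_smul, ← Complex.exp_add,
      sub_add_cancel]
  rw [h3] at h2
  have h4 := h1.unique hst (f.intervalIntegrable hs hst) (g.intervalIntegrable hs hst) h2 t
    (Set.right_mem_Icc.mpr hst)
  refine (inner_slice u (expVec f') _).symm.trans ((congrArg _ h4).trans ?_)
  exact (inner_smul_right u _ c).trans (congrArg (c * ·) (inner_slice u (expVec f) _))

/-- `U(t, s)` commutes weakly with the quadratures up to time `s`. -/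
theorem inner_fieldVec_eq (hU : IsTimeOrderedExponential L H U) {s t : ℝ} (hs : 0 ≤ s)
    (hst : s ≤ t) (k : Fin n) (u v : 𝔥) (f g : OneParticle n) :
    ⟪htmul u (fieldVec (channelIndicator k s) f), (U t s).1 (htmul v (expVec g))⟫_ℂ =
      ⟪htmul u (expVec f), (U t s).1 (htmul v (fieldVec (channelIndicator k s) g))⟫_ℂ := by
  have hrefl : ∀ f : OneParticle n, ∀ᵐ r ∂volume.restrict (Set.Ioc s t), f r = f r :=
    fun f => Filter.Eventually.of_forall fun r => rfl
  refine inner_fieldVec_eq_of_factorises (fun u v f g l => ?_) (fun u v f g l => ?_) u v f g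
  · refine (hU.inner_eq_exp_mul hs hst u v (add_smul_channelIndicator_ae f l k hs)
      (hrefl g)).trans ?_
    congr 2
    rw [inner_add_left, inner_smul_left, Complex.conj_ofReal, add_sub_cancel_left]
  · refine (hU.inner_eq_exp_mul hs hst u v (hrefl f)
      (add_smul_channelIndicator_ae g l k hs)).trans ?_
    congr 2
    rw [inner_add_right, inner_smul_right, add_sub_cancel_left]

/-! ### Future subspaces and the flow property -/

/-- The closed span of the vectors `w ⊗ e(g')` with `g' = g` after time `s`. -/
def futureSubspace (𝔥 : Type*) [NormedAddCommGroup 𝔥] [InnerProductSpace ℂ 𝔥] (s : ℝ)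
    (g : OneParticle n) : Submodule ℂ (HTensor 𝔥 (Bath n)) :=
  (Submodule.span ℂ {x | ∃ (w : 𝔥) (g' : OneParticle n),
    (∀ᵐ r ∂volume.restrict (Set.Ici (0 : ℝ)), s < r → g' r = g r) ∧
      x = htmul w (expVec g')}).topologicalClosure

/-- Evolution up to time `s` leaves the field after `s` in its coherent state. Its matrix elements
cannot tell `u ⊗ e(f)` from the projection of this vector to the subspace. -/
theorem mem_futureSubspace (hU : IsTimeOrderedExponential L H U) {s : ℝ} (hs : 0 ≤ s) (v : 𝔥)
    (g : OneParticle n) : (U s 0).1 (htmul v (expVec g)) ∈ futureSubspace 𝔥 s g := by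
  have hd : ∀ f : OneParticle n, ∀ᵐ r ∂volume.restrict (Set.Ici (0 : ℝ)),
      (s < r → (f + (g - f).after s : OneParticle n) r = g r) ∧
      (¬ s < r → (f + (g - f).after s : OneParticle n) r = f r) ∧
      (¬ s < r → (g - f).after s r = 0) := by
    intro f
    filter_upwards [OneParticle.after_ae s (g - f), Lp.coeFn_sub g f,
      Lp.coeFn_add f ((g - f).after s)] with r h1 h2 h3
    have h0 : ¬ s < r → (g - f).after s r = 0 := fun hr =>
      h1.trans (Set.indicator_of_notMem hr _)
    refine ⟨fun hr => ?_, fun hr => ?_, h0⟩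
    · have h4 : (g - f).after s r = (g - f : OneParticle n) r :=
        h1.trans (Set.indicator_of_mem hr _)
      rw [h3, Pi.add_apply, h4, h2, Pi.sub_apply, add_sub_cancel]
    · rw [h3, Pi.add_apply, h0 hr, add_zero]
  -- With `d = (g - f).after s`, the projection replaces `f` by `f + d`, which equals `g` after `s`
  -- and `f` before. The prefactor is fixed by `⟪g', d⟫ = ⟪g, d⟫` for every admissible `g'`.
  refine Submodule.mem_topologicalClosure_span_of_inner_eq
    (a := fun p : 𝔥 × OneParticle n => htmul p.1 (expVec p.2))
    (b := fun p => Complex.exp (-⟪g, (g - p.2).after s⟫_ℂ) •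
      htmul p.1 (expVec (p.2 + (g - p.2).after s)))
    (fun ψ hψ => eq_zero_of_inner_htmul_expVec fun u f => hψ (u, f)) ?_ ?_ ?_
  · rintro ⟨u, f⟩
    refine Submodule.smul_mem _ _ (Submodule.le_topologicalClosure _ (Submodule.subset_span
      ⟨u, f + (g - f).after s, ?_, rfl⟩))
    filter_upwards [hd f] with r hr using hr.1
  · rintro _ ⟨w, g', hg', rfl⟩ ⟨u, f⟩
    refine inner_htmul_expVec_shift u w (OneParticle.inner_congr ?_)
    filter_upwards [hd f, hg'] with r h1 h2
    by_cases hr : s < r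
    · exact Or.inr (h2 hr)
    · exact Or.inl (h1.2.2 hr)
  · rintro ⟨u, f⟩
    have hfd : ∀ᵐ r ∂volume.restrict (Set.Ioc 0 s),
        (f + (g - f).after s : OneParticle n) r = f r := by
      filter_upwards [ae_restrict_Ioc_of_ae_restrict_Ici (t := s) le_rfl (hd f)] with r hr
      exact hr.2.2.2.1 (not_lt.mpr hr.2.1)
    exact inner_exp_smul_left_eq (hU.inner_eq_exp_mul le_rfl hs u v hfd
      (Filter.Eventually.of_forall fun r => (rfl : g r = g r)))

/-- The integral equation for `U(t, s)` extends to `futureSubspace`. -/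
theorem isWeakSolution_of_mem_futureSubspace (hU : IsTimeOrderedExponential L H U) {s t : ℝ}
    (hs : 0 ≤ s) (hst : s ≤ t) (f g : OneParticle n) {ξ : HTensor 𝔥 (Bath n)}
    (hξ : ξ ∈ futureSubspace 𝔥 s g) :
    IsWeakSolution L H f g s t (fun r => slice (expVec f) ((U r s).1 ξ)) (slice (expVec f) ξ) := by
  refine IsWeakSolution.of_mem_topologicalClosure_span (V := fun r => (U r s).1)
    (f.intervalIntegrable hs hst) (g.intervalIntegrable hs hst)
    (fun r x => Unitary.norm_map (U r s) x)
    (fun x => (hU.continuousOn s hs x).mono Set.Icc_subset_Ici_self) ?_ hξ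
  rintro _ ⟨w, g', hg', rfl⟩
  refine (hU.isWeakSolution_slice hs t w f g').congr_ae
    (Filter.Eventually.of_forall fun r => rfl) ?_
  filter_upwards [ae_restrict_Ioc_of_ae_restrict_Ici (t := t) hs hg'] with r hr
  exact hr.2.2 hr.1

/-- The flow property. -/
theorem mul_eq (hU : IsTimeOrderedExponential L H U) {s t : ℝ} (hs : 0 ≤ s) (hst : s ≤ t) :
    (U t 0).1 = (U t s).1 * (U s 0).1 := by
  refine ContinuousLinearMap.ext_on dense_span_htmul_expVec ?_
  rintro _ ⟨⟨v, g⟩, rfl⟩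
  refine eq_of_inner_htmul_expVec fun u f => ?_
  have ht := hs.trans hst
  -- On `[s, t]` both `U(r,0) (v ⊗ e(g))` and `U(r,s) U(s,0) (v ⊗ e(g))`, sliced by `e(f)`, solve
  -- the equation with coefficients `f`, `g` and start from the same vector at `s`.
  have h1 := (hU.isWeakSolution_slice le_rfl t v f g).restrict hs hst
    (f.intervalIntegrable le_rfl ht) (g.intervalIntegrable le_rfl ht)
  have h2 := hU.isWeakSolution_of_mem_futureSubspace (t := t) hs hst f g
    (hU.mem_futureSubspace hs v g)
  have h3 := h1.unique hst (f.intervalIntegrable hs hst) (g.intervalIntegrable hs hst) h2 t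
    (Set.right_mem_Icc.mpr hst)
  rw [← inner_slice, ← inner_slice]
  exact congrArg _ h3

end IsTimeOrderedExponential

variable {L : Fin n → 𝔥 →L[ℂ] 𝔥} {H : 𝔥 →L[ℂ] 𝔥}
  {U : ℝ → ℝ → unitary (HTensor 𝔥 (Bath n) →L[ℂ] HTensor 𝔥 (Bath n))}

theorem IsTimeOrderedExponential.exists_commute (hU : IsTimeOrderedExponential L H U)
    {s t : ℝ} (hs : 0 ≤ s) (hst : s ≤ t) (j k : Fin n) {z w : ℂ} (hz : z.im ≠ 0) (hw : w.im ≠ 0) :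
    ∃ R S : HTensor 𝔥 (Bath n) →L[ℂ] HTensor 𝔥 (Bath n),
      IsResolvent (outputQuadrature U j t) z R ∧ IsResolvent (outputQuadrature U k s) w S ∧
        Commute R S := by
  have hj := hasSelfAdjointCore_idTensor_inputQuadrature (𝔥 := 𝔥) j t
  have hk := hasSelfAdjointCore_idTensor_inputQuadrature (𝔥 := 𝔥) k s
  obtain ⟨R, hR⟩ := hj.exists_isResolvent hz
  obtain ⟨S, hS⟩ := hk.exists_isResolvent hw
  have hRS : Commute R S :=
    commute_isResolvent_fieldOp (inner_channelIndicator_comm j k s t) hz hw hR hS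
  have hSV : Commute S (U t s).1 := hk.commute_of_isResolvent hw hS fun p q =>
    hU.inner_fieldVec_eq hs hst k q.1 p.1 q.2 p.2
  exact hR.exists_commute_unitaryConj hS hRS (hU.mul_eq hs hst) hSV

end Evolution

end

theorem mainTheorem6 {n : ℕ} {𝔥 : Type*} [NormedAddCommGroup 𝔥] [InnerProductSpace ℂ 𝔥]
    [CompleteSpace 𝔥] (L : Fin n → 𝔥 →L[ℂ] 𝔥) (H : 𝔥 →L[ℂ] 𝔥) (hH : IsSelfAdjoint H)
    (U : ℝ → ℝ → unitary (HTensor 𝔥 (Bath n) →L[ℂ] HTensor 𝔥 (Bath n)))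
    (hU : IsTimeOrderedExponential L H U) (T : ℝ)
    (j k : Fin n) (s t : ℝ) (hs : s ∈ Set.Icc 0 T) (ht : t ∈ Set.Icc 0 T) :
    StronglyCommute (outputQuadrature U j t) (outputQuadrature U k s) ∧
      CommutatorVanishes (outputQuadrature U j t) (outputQuadrature U k s) := by
  have hcomm : ∀ z w : ℂ, z.im ≠ 0 → w.im ≠ 0 →
      ∃ R S : HTensor 𝔥 (Bath n) →L[ℂ] HTensor 𝔥 (Bath n),
        IsResolvent (outputQuadrature U j t) z R ∧ IsResolvent (outputQuadrature U k s) w S ∧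
          Commute R S := by
    intro z w hz hw
    -- The factorisation of the evolution needs the earlier time to be second; the other order
    -- follows by exchanging the two operators.
    rcases le_total s t with hst | hts
    · exact hU.exists_commute hs.1 hst j k hz hw
    · obtain ⟨S, R, hS, hR, hSR⟩ := hU.exists_commute ht.1 hts k j hw hz
      exact ⟨R, S, hR, hS, hSR.symm⟩
  refine ⟨⟨isSelfAdjoint_outputQuadrature U j t, isSelfAdjoint_outputQuadrature U k s, hcomm⟩, ?_⟩
  obtain ⟨R, S, hR, hS, hRS⟩ := hcomm Complex.I Complex.I (by simp) (by simp)
  exact CommutatorVanishes.of_commute_isResolvent hR hS hRS
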